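/- Let $G$ be a countable directed graph (multiple edges and loops allowed), with source and range maps $s,r$, and let $\mathbb F^+(G)$ be the set of all vertices (paths of length $0$, with $s(x)=r(x)=x$) and all finite directed paths $w=e_m\cdots e_1$, $s(e_{i+1})=r(e_i)$. Let $\mathcal H_G$ be the complex Hilbert space with orthonormal basis $\{\xi_w : w\in\mathbb F^+(G)\}$. For an edge $e$ let $L_e\in B(\mathcal H_G)$ be given by $L_e\xi_w=\xi_{ew}$ if $r(w)=s(e)$ and $L_e\xi_w=0$ otherwise; for a vertex $x$ let $P_x$ be the projection onto the closed span of $\{\xi_w : r(w)=x\}$. Let $\mathfrak L_G$ be the closure in the weak operator topology of the norm-closed algebra generated by all $L_e$ and $P_x$. The saturation of a vertex $x$ is the set of vertices that can be reached from $x$ along a directed path. A loop is a path of positive length from a vertex to itself; two loops are called distinct if they do not traverse the same set of edges (so a loop is not distinct from its powers and cyclic shifts). An infinite proper path is an infinite directed path $x_0\to x_1\to x_2\to\cdots$ through pairwise distinct vertices. $G$ has the uniform aperiodic path property if for every vertex $x$ the saturation of $x$ contains two distinct loops or an infinite proper path. **Theorem.** Let $G$ be a countable directed graph with the uniform aperiodic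 path property, let $A\in\mathfrak L_G$, and let $k\ge 1$ be an integer with $\|A\|<1-\frac1k$. Then $A$ is the average of $6k$ isometries in $\mathfrak L_G$: there are isometries $U_1,\dots,U_{6k}\in\mathfrak L_G$ (not necessarily distinct) with $A=\frac1{6k}\sum_{i=1}^{6k}U_i$. -/

import Mathlib

open scoped InnerProductSpace lp

noncomputable section

/-! A directed graph, with multiple edges and loops allowed, is a `Quiver` on its vertex type `V`:
`e : a ⟶ b` is an edge with source `a` and range `b`, and `Quiver.Path a b` is the type of finite
paths with source `a` and range `b` (including the path of length `0` at a vertex). -/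

namespace DirectedGraph

universe u v

/-! ### The uniform aperiodic path property -/

section Graph

variable {V : Type u} [Quiver.{v} V]

/-- The saturation of a vertex `x`: the vertices that can be reached from `x` along a (directed)
path. Every path that starts in the saturation stays in it. -/
def saturation (x : V) : Set V :=
  {y | Nonempty (Quiver.Path x y)}

/-- The set of edges traversed by a path. -/
def edgeSet {a : V} : ∀ {b : V}, Quiver.Path a b → Set (Quiver.Total V)
  | _, Quiver.Path.nil => ∅
  | _, Quiver.Path.cons p e => insert ⟨_, _, e⟩ (edgeSet p)

/-- A set `S` of vertices, closed under following edges, contains two distinct loops. A loop is a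
path of positive length from a vertex to itself. Distinct loops are loops that do not traverse the
same edges: a loop is not regarded as distinct from its powers or its cyclic shifts. -/
def ContainsTwoDistinctLoops (S : Set V) : Prop :=
  ∃ y ∈ S, ∃ z ∈ S, ∃ (p : Quiver.Path y y) (q : Quiver.Path z z),
    0 < p.length ∧ 0 < q.length ∧ edgeSet p ≠ edgeSet q

/-- A set `S` of vertices contains an infinite proper path: an infinite path that runs through
pairwise distinct vertices, all of them in `S`. -/
def ContainsInfiniteProperPath (S : Set V) : Prop :=
  ∃ y : ℕ → V, Function.Injective y ∧ (∀ n, y n ∈ S) ∧ ∀ n, Nonempty (y n ⟶ y (n + 1))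

variable (V) in
/-- The uniform aperiodic path property of the directed graph `V`. -/
def UniformAperiodicPathProperty : Prop :=
  ∀ x : V, ContainsTwoDistinctLoops (saturation x) ∨ ContainsInfiniteProperPath (saturation x)

end Graph

/-! ### Operators on `ℓ²(ι)` induced by partial injections of `ι` -/

section PartialInjection

variable {ι : Type*}

/-- The partial map `g` (with value `none` where it is undefined) is injective where defined. -/
def PartialInjective (g : ι → Option ι) : Prop :=
  ∀ a b c, g a = some c → g b = some c → a = b

theorem sum_elim_le {g : ι → Option ι} (hg : PartialInjective g) (f : ℓ²(ι, ℂ)) (s : Finset ι) :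
    ∑ a ∈ s, ‖((g a).elim 0 f : ℂ)‖ ^ (2 : ENNReal).toReal ≤ ‖f‖ ^ (2 : ENNReal).toReal := by
  classical
  have h2 : (0 : ℝ) < (2 : ENNReal).toReal := by norm_num
  have hinj : ∀ (a b : ι) (c : ι), c ∈ g a → c ∈ g b → a = b := fun a b c ha hb => hg a b c ha hb
  calc ∑ a ∈ s, ‖((g a).elim 0 f : ℂ)‖ ^ (2 : ENNReal).toReal
      = ∑ a ∈ s.filter (fun a => (g a).isSome),
          ‖((g a).elim 0 f : ℂ)‖ ^ (2 : ENNReal).toReal := by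
        rw [Finset.sum_filter]
        refine Finset.sum_congr rfl fun a _ => ?_
        cases h : g a <;> simp
    _ = ∑ c ∈ s.filterMap g hinj, ‖f c‖ ^ (2 : ENNReal).toReal := by
        refine Finset.sum_bij' (fun a ha => (g a).get (Finset.mem_filter.1 ha).2)
          (fun c hc => ((Finset.mem_filterMap g (f_inj := hinj)).1 hc).choose) ?_ ?_ ?_ ?_ ?_
        · intro a ha
          exact (Finset.mem_filterMap g (f_inj := hinj)).2 ⟨a, (Finset.mem_filter.1 ha).1, by simp⟩
        · intro c hc
          have h := ((Finset.mem_filterMap g (f_inj := hinj)).1 hc).choose_spec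
          exact Finset.mem_filter.2 ⟨h.1, by simp [h.2]⟩
        · intro a ha
          have h1 : (g a).get (Finset.mem_filter.1 ha).2 ∈ s.filterMap g hinj :=
            (Finset.mem_filterMap g (f_inj := hinj)).2 ⟨a, (Finset.mem_filter.1 ha).1, by simp⟩
          have h := ((Finset.mem_filterMap g (f_inj := hinj)).1 h1).choose_spec
          exact hg _ _ _ h.2 (by simp)
        · intro c hc
          have h := ((Finset.mem_filterMap g (f_inj := hinj)).1 hc).choose_spec
          simp [h.2]
        · intro a ha
          obtain ⟨c, hc⟩ := Option.isSome_iff_exists.1 (Finset.mem_filter.1 ha).2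
          simp [hc]
    _ ≤ ‖f‖ ^ (2 : ENNReal).toReal := lp.sum_rpow_le_norm_rpow h2 f _

/-- The contraction `f ↦ f ∘ g` of `ℓ²(ι)`, where `f ∘ g` is `0` where `g` is undefined. -/
def pullback (g : ι → Option ι) (hg : PartialInjective g) : ℓ²(ι, ℂ) →L[ℂ] ℓ²(ι, ℂ) :=
  LinearMap.mkContinuous
    { toFun := fun f => ⟨fun a => (g a).elim 0 f, memℓp_gen' (sum_elim_le hg f)⟩
      map_add' := fun f f' => by
        ext a
        change ((g a).elim 0 (f + f' : ℓ²(ι, ℂ)) : ℂ) = (g a).elim 0 f + (g a).elim 0 f'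
        cases g a
        · exact (add_zero 0).symm
        · rfl
      map_smul' := fun c f => by
        ext a
        change ((g a).elim 0 (c • f : ℓ²(ι, ℂ)) : ℂ) = c * (g a).elim 0 f
        cases g a <;> simp } 1
    (fun f => by
      rw [one_mul]
      exact lp.norm_le_of_forall_sum_le (by norm_num) (norm_nonneg f) (sum_elim_le hg f))

theorem pullback_apply (g : ι → Option ι) (hg : PartialInjective g) (f : ℓ²(ι, ℂ)) (a : ι) :
    pullback g hg f a = (g a).elim 0 f := rfl

/-- The partial isometry of `ℓ²(ι)` that maps the basis vector at `a` to the basis vector at `g a`,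
or to `0` if `g a` is undefined; see `pushforward_single`. -/
def pushforward (g : ι → Option ι) (hg : PartialInjective g) : ℓ²(ι, ℂ) →L[ℂ] ℓ²(ι, ℂ) :=
  ContinuousLinearMap.adjoint (pullback g hg)

open Classical in
theorem pushforward_single (g : ι → Option ι) (hg : PartialInjective g) (a : ι) :
    pushforward g hg (lp.single 2 a 1) = (g a).elim 0 (fun b => lp.single 2 b 1) := by
  ext c
  have h1 : ∀ f : ℓ²(ι, ℂ), f c = ⟪(lp.single 2 c (1 : ℂ) : ℓ²(ι, ℂ)), f⟫_ℂ := fun f => by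
    rw [lp.inner_single_left]; simp
  rw [h1, pushforward, ContinuousLinearMap.adjoint_inner_right, lp.inner_single_right,
    pullback_apply]
  cases h : g a with
  | none => simp
  | some b =>
    by_cases hbc : b = c
    · subst hbc; simp
    · simp [hbc, Ne.symm hbc]

end PartialInjection

/-! ### The free semigroupoid, its Fock space, and the left creation operators -/

section Fock

variable (V : Type u) [Quiver.{v} V]

/-- The free semigroupoid of the graph: all vertices (paths of length `0`) and all finite paths. -/
structure FreeSemigroupoid where
  /-- the source vertex `s(w)` -/
  source : V
  /-- the range vertex `r(w)` -/
  range : V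
  /-- the path itself -/
  path : Quiver.Path source range

/-- The Hilbert space with orthonormal basis indexed by the free semigroupoid. -/
abbrev FockSpace := ℓ²(FreeSemigroupoid V, ℂ)

variable {V}

open Classical in
/-- The basis vector `ξ_w`. -/
def basisVector (w : FreeSemigroupoid V) : FockSpace V := lp.single 2 w 1

open Classical in
/-- The partial map `w ↦ ew`, defined for those `w` with `r(w) = s(e)`. -/
def extend {a b : V} (e : a ⟶ b) (w : FreeSemigroupoid V) : Option (FreeSemigroupoid V) :=
  if h : w.range = a then some ⟨w.source, b, (h ▸ w.path).cons e⟩ else none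

theorem extend_injective {a b : V} (e : a ⟶ b) : PartialInjective (extend e) := by
  rintro ⟨s, r, p⟩ ⟨s', r', p'⟩ c h h'
  by_cases hr : r = a
  · by_cases hr' : r' = a
    · subst hr
      subst hr'
      simp only [extend, dite_true] at h h'
      have h2 := (Option.some.inj h).trans (Option.some.inj h').symm
      injection h2 with h3 h4 h5
      subst h3
      have h6 := (Quiver.Path.cons.inj (eq_of_heq h5)).2.1.eq
      rw [h6]
    · simp [extend, hr'] at h'
  · simp [extend, hr] at h

open Classical in
/-- The partial map that fixes the `w` with `r(w) = x` and is undefined elsewhere. -/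
def restrict (x : V) (w : FreeSemigroupoid V) : Option (FreeSemigroupoid V) :=
  if w.range = x then some w else none

theorem restrict_injective (x : V) : PartialInjective (restrict x) := by
  intro w w' c h h'
  by_cases hw : w.range = x
  · by_cases hw' : w'.range = x
    · simp only [restrict, hw, hw', if_true, Option.some.injEq] at h h'
      rw [h, h']
    · simp [restrict, hw'] at h'
  · simp [restrict, hw] at h

/-- The left creation operator `L_e`: `L_e ξ_w = ξ_{ew}` if `r(w) = s(e)`, and `0` otherwise. -/
def creation {a b : V} (e : a ⟶ b) : FockSpace V →L[ℂ] FockSpace V :=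
  pushforward (extend e) (extend_injective e)

/-- The vertex projection `P_x`: `P_x ξ_w = ξ_w` if `r(w) = x`, and `0` otherwise. -/
def vertexProjection (x : V) : FockSpace V →L[ℂ] FockSpace V :=
  pushforward (restrict x) (restrict_injective x)

theorem creation_basisVector {x a b : V} (e : a ⟶ b) (p : Quiver.Path x a) :
    creation e (basisVector ⟨x, a, p⟩) = basisVector ⟨x, b, p.cons e⟩ := by
  simp [creation, basisVector, pushforward_single, extend]

theorem creation_basisVector_of_ne {a b : V} (e : a ⟶ b) (w : FreeSemigroupoid V)
    (h : w.range ≠ a) : creation e (basisVector w) = 0 := by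
  simp [creation, basisVector, pushforward_single, extend, h]

theorem vertexProjection_basisVector (w : FreeSemigroupoid V) :
    vertexProjection w.range (basisVector w) = basisVector w := by
  simp [vertexProjection, basisVector, pushforward_single, restrict]

theorem vertexProjection_basisVector_of_ne (x : V) (w : FreeSemigroupoid V) (h : w.range ≠ x) :
    vertexProjection x (basisVector w) = 0 := by
  simp [vertexProjection, basisVector, pushforward_single, restrict, h]

variable (V)

/-- The operators `L_e` (over all edges `e`) and `P_x` (over all vertices `x`). -/
def generators : Set (FockSpace V →L[ℂ] FockSpace V) :=
  {T | ∃ (a b : V) (e : a ⟶ b), T = creation e} ∪ Set.range vertexProjection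

/-- The quiver algebra: the norm-closed algebra generated by the `L_e` and the `P_x`. -/
def quiverAlgebra : NonUnitalSubalgebra ℂ (FockSpace V →L[ℂ] FockSpace V) :=
  (NonUnitalAlgebra.adjoin ℂ (generators V)).topologicalClosure

/-- The free semigroupoid algebra: the operators in the closure of the quiver algebra in the weak
operator topology. -/
def freeSemigroupoidAlgebra : Set (FockSpace V →L[ℂ] FockSpace V) :=
  {A | ContinuousLinearMapWOT.ofCLM A ∈
    closure ((fun T => (ContinuousLinearMapWOT.ofCLM T : FockSpace V →WOT[ℂ] FockSpace V)) ''
      (quiverAlgebra V : Set (FockSpace V →L[ℂ] FockSpace V)))}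

end Fock

end DirectedGraph

end

/-! The algebra $\mathfrak L_G$ is the commutant of the right translations $R_w\xi_v=\xi_{vw}$
(`mem_freeSemigroupoidAlgebra_iff`). One inclusion is immediate. For the other, an operator $T$ in
the commutant is determined by its values at the vertex vectors, hence has a Fourier expansion in
the left translations; its Abel means lie in the quiver algebra, are bounded by $\|T\|$ by the
maximum principle, and converge to $T$ on matrix coefficients. All constructions are then made
inside the commutant, which is an inverse-closed algebra.

Two facts about the commutant carry the proof. First, it contains two isometries with orthogonal
ranges (`exists_isOrthogonalPair`). This is where the graph property enters: two paths can be chosen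
out of every vertex such that none of all these paths is a terminal segment of another
(`exists_code`), and prolonging every $w$ by the first, or by the second, path chosen at $r(w)$
gives the two isometries. Secondly, every strict contraction $X$ in it has a partner $Y$ in it with
$X^*X+Y^*Y=1$ (`exists_isometric_column`). Here $1-X^*X$ is an invertible positive Toeplitz
operator, and it is factored as $Y^*Y$ by orthonormalising right translates of wandering vectors
(`IsToeplitz.exists_factor`).

If $P,R$ are isometries with orthogonal ranges, then $PX\pm RY$ are isometries, so $2PX$ is a sum of
two of them. It remains to pass from $PX$ to $X$. For a root of unity $\omega$ of order $N+1$ and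
$t=N/(N+1)$, the Möbius transforms $P_j$ of $\omega^jS$ are isometries, each with a partner of
orthogonal range, and $\sum_jP_j=N-2SZ$ with $\|Z\|<1$ (`exists_sum_moebius`). Hence
$2NB=\sum_j2P_jB+2\cdot 2SZB$ is a sum of $2(N+1)+4$ isometries whenever $\|B\|<1$. For $k=n+1$, the
choice $N=3n$, $B=\frac{n+1}nA$ writes $6kA$ as a sum of $6k$ isometries. -/

noncomputable section

namespace DirectedGraph

universe u v

open ContinuousLinearMap (adjoint)

/-! ### Paths -/

section Paths

variable {V : Type u} [Quiver.{v} V]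

/-- Of two initial segments of a path, the shorter one is an initial segment of the longer one. -/
theorem exists_comp_eq_of_comp_eq {a b c d : V} {p : Quiver.Path a b} {p' : Quiver.Path b d}
    {q : Quiver.Path a c} {q' : Quiver.Path c d} (h : p.comp p' = q.comp q')
    (hl : p.length ≤ q.length) : ∃ r : Quiver.Path b c, q = p.comp r ∧ p' = r.comp q' := by
  induction q' with
  | nil => exact ⟨p', h.symm, rfl⟩
  | cons q' e ih =>
    cases p' with
    | nil =>
      have := congrArg Quiver.Path.length h
      simp only [Quiver.Path.comp_nil, Quiver.Path.length_comp, Quiver.Path.length_cons] at this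
      omega
    | cons p' e' =>
      simp only [Quiver.Path.comp_cons] at h
      obtain ⟨h1, h2, h3⟩ := Quiver.Path.cons.inj h
      subst h1
      obtain ⟨r, hr, hr'⟩ := ih (eq_of_heq h2)
      exact ⟨r, hr, by rw [hr', eq_of_heq h3, Quiver.Path.comp_cons]⟩

/-- The powers of a loop. -/
def loopPow {y : V} (α : Quiver.Path y y) : ℕ → Quiver.Path y y
  | 0 => Quiver.Path.nil
  | n + 1 => (loopPow α n).comp α

theorem loopPow_add {y : V} (α : Quiver.Path y y) (m n : ℕ) :
    loopPow α (m + n) = (loopPow α m).comp (loopPow α n) := by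
  induction n with
  | zero => rfl
  | succ n ih => rw [← add_assoc, loopPow, ih, loopPow, Quiver.Path.comp_assoc]

theorem length_loopPow {y : V} (α : Quiver.Path y y) (n : ℕ) :
    (loopPow α n).length = n * α.length := by
  induction n with
  | zero => simp [loopPow]
  | succ n ih => rw [loopPow, Quiver.Path.length_comp, ih]; ring

theorem edgeSet_comp {a b c : V} (p : Quiver.Path a b) (q : Quiver.Path b c) :
    edgeSet (p.comp q) = edgeSet p ∪ edgeSet q := by
  induction q with
  | nil => simp [edgeSet]
  | cons q e ih => simp [edgeSet, ih]

theorem edgeSet_loopPow_subset {y : V} (α : Quiver.Path y y) (n : ℕ) :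
    edgeSet (loopPow α n) ⊆ edgeSet α := by
  induction n with
  | zero => simp [loopPow, edgeSet]
  | succ n ih => rw [loopPow, edgeSet_comp]; exact Set.union_subset ih subset_rfl

/-! ### Branching loops and codes of paths -/

/-- There are two different loops of the same length at `y`. -/
def HasBranchingLoops (y : V) : Prop :=
  ∃ α β : Quiver.Path y y, α.length = β.length ∧ α ≠ β

/-- The two loops are the two products of $p$ and $q$. If they agreed, $p$ would commute with all
powers of $q$, hence be an initial segment of a long power of $q$, and could not leave the edges of
$q$. -/
theorem hasBranchingLoops_of_edgeSet {y : V} {p q : Quiver.Path y y} (hq : 0 < q.length)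
    {e : Quiver.Total V} (hp : e ∈ edgeSet p) (he : e ∉ edgeSet q) : HasBranchingLoops y := by
  refine ⟨p.comp q, q.comp p, by simp [add_comm], fun h => he ?_⟩
  have hc : ∀ n, p.comp (loopPow q n) = (loopPow q n).comp p := fun n => by
    induction n with
    | zero => simp [loopPow]
    | succ n ih =>
      rw [loopPow, ← Quiver.Path.comp_assoc, ih, Quiver.Path.comp_assoc, h,
        Quiver.Path.comp_assoc]
  obtain ⟨r, hr, -⟩ := exists_comp_eq_of_comp_eq (hc p.length) (by
    rw [length_loopPow]; exact Nat.le_mul_of_pos_right _ hq)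
  refine edgeSet_loopPow_subset q p.length ?_
  rw [hr, edgeSet_comp]
  exact Or.inl hp

theorem saturation_subset {x y : V} (h : y ∈ saturation x) : saturation y ⊆ saturation x := by
  rintro z ⟨q⟩
  obtain ⟨p⟩ := h
  exact ⟨p.comp q⟩

theorem mem_saturation_self (x : V) : x ∈ saturation x := ⟨Quiver.Path.nil⟩

/-- Under the uniform aperiodic path property, every vertex leads to a vertex with branching loops
or to infinitely many vertices. -/
theorem UniformAperiodicPathProperty.exists_or_infinite (hG : UniformAperiodicPathProperty V)
    (x : V) : (∃ y ∈ saturation x, HasBranchingLoops y) ∨ (saturation x).Infinite := by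
  by_contra! hx
  obtain ⟨hD, hfin⟩ := hx
  -- A vertex whose saturation has least cardinality has a strongly connected saturation, so any two
  -- loops there can be moved to a common base vertex.
  obtain ⟨y, hy, hmin⟩ := Set.exists_min_image (saturation x) (fun y => (saturation y).ncard) hfin
    ⟨x, mem_saturation_self x⟩
  have hyfin : (saturation y).Finite := hfin.subset (saturation_subset hy)
  have hconn : ∀ z ∈ saturation y, ∀ w ∈ saturation y, Nonempty (Quiver.Path z w) := by
    intro z hz w hw
    have := Set.eq_of_subset_of_ncard_le (saturation_subset hz)
      (hmin z (saturation_subset hy hz)) hyfin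
    rw [← this] at hw
    exact hw
  rcases hG y with ⟨z, hz, w, hw, p, q, hp, hq, hne⟩ | ⟨f, hf, hfS, -⟩
  · have key : ∀ z ∈ saturation y, ∀ w ∈ saturation y, ∀ (p : Quiver.Path z z)
        (q : Quiver.Path w w), 0 < q.length → edgeSet p ⊆ edgeSet q := by
      intro z hz w hw p q hq e he
      by_contra hne
      obtain ⟨r⟩ := hconn z hz w hw
      obtain ⟨r'⟩ := hconn w hw z hz
      refine hD w (saturation_subset hy hw) (hasBranchingLoops_of_edgeSet
        (p := (r'.comp p).comp r) hq (e := e) ?_ hne)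
      simp [edgeSet_comp, he]
    exact hne (Set.Subset.antisymm (key z hz w hw p q hq) (key w hw z hz q p hp))
  · exact Set.infinite_of_injective_forall_mem hf hfS hyfin

/-- A countable family of infinite subsets of a countable type has an injective choice function. -/
theorem exists_injective_choice {κ α : Type*} [Countable κ] [Countable α] (S : κ → Set α)
    (hS : ∀ k, (S k).Infinite) : ∃ f : κ → α, Function.Injective f ∧ ∀ k, f k ∈ S k := by
  rcases isEmpty_or_nonempty κ with hκ | hκ
  · exact ⟨fun k => (hκ.false k).elim, fun k => (hκ.false k).elim, fun k => (hκ.false k).elim⟩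
  obtain ⟨enc, henc⟩ := exists_injective_nat α
  obtain ⟨g, hg⟩ := exists_surjective_nat κ
  have hex : ∀ (k : κ) (m : ℕ), ∃ y ∈ S k, m < enc y := by
    intro k m
    have h1 := (hS k).image henc.injOn
    obtain ⟨_, ⟨y, hy, rfl⟩, hm⟩ := h1.exists_gt m
    exact ⟨y, hy, hm⟩
  choose F hFS hF using hex
  -- Each choice has a larger code than the preceding one, which forces injectivity.
  let f : ℕ → α := fun n => Nat.rec (F (g 0) 0) (fun n y => F (g (n + 1)) (enc y)) n
  have hmem : ∀ n, f n ∈ S (g n) := fun n => by cases n <;> exact hFS _ _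
  have hmono : StrictMono (enc ∘ f) := strictMono_nat_of_lt_succ fun n => hF _ _
  refine ⟨fun k => f (Function.surjInv hg k), ?_, fun k => ?_⟩
  · intro k l h
    have := hmono.injective (congrArg enc h)
    exact Function.injective_surjInv hg this
  · have := hmem (Function.surjInv hg k)
    rwa [Function.surjInv_eq hg k] at this

/-- Under the uniform aperiodic path property, countably many paths with prescribed sources can be
chosen such that none of them is a terminal segment of another one. -/
theorem UniformAperiodicPathProperty.exists_code [Countable V]
    (hG : UniformAperiodicPathProperty V) {κ : Type*} [Countable κ] (x : κ → V) :
    ∃ c : ∀ k, Σ y, Quiver.Path (x k) y, ∀ (k l : κ) (s : V) (p : Quiver.Path s (x k))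
      (q : Quiver.Path s (x l)),
      (⟨(c k).1, p.comp (c k).2⟩ : Σ y, Quiver.Path s y) = ⟨(c l).1, q.comp (c l).2⟩ → k = l := by
  obtain ⟨n, hn⟩ := exists_injective_nat κ
  obtain ⟨f, hf, hfS⟩ := exists_injective_choice
    (κ := {k : κ // ¬ ∃ y ∈ saturation (x k), HasBranchingLoops y})
    (fun k => saturation (x k.1)) (fun k => (hG.exists_or_infinite (x k.1)).resolve_left k.2)
  have hD : ∀ y : {y : V // HasBranchingLoops y}, ∃ α β : Quiver.Path y.1 y.1,
    α.length = β.length ∧ α ≠ β := fun y => y.2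
  -- The pair of loops depends on the vertex only, so two code words that end at the same branching
  -- vertex are built from the same pair.
  choose α β hlen hne using hD
  have hc : ∀ k, ∃ c : Σ y, Quiver.Path (x k) y,
      (∃ (hy : HasBranchingLoops c.1) (p : Quiver.Path (x k) c.1),
        c.2 = (p.comp (β ⟨c.1, hy⟩)).comp (loopPow (α ⟨c.1, hy⟩) (n k))) ∨
      (¬ HasBranchingLoops c.1 ∧ ∃ hk, c.1 = f ⟨k, hk⟩) := by
    intro k
    by_cases hk : ∃ y ∈ saturation (x k), HasBranchingLoops y
    · obtain ⟨y, ⟨p⟩, hy⟩ := hk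
      exact ⟨⟨y, (p.comp (β ⟨y, hy⟩)).comp (loopPow (α ⟨y, hy⟩) (n k))⟩, Or.inl ⟨hy, p, rfl⟩⟩
    · obtain ⟨p⟩ := hfS ⟨k, hk⟩
      exact ⟨⟨_, p⟩, Or.inr ⟨fun h => hk ⟨_, ⟨p⟩, h⟩, hk, rfl⟩⟩
  choose c hc using hc
  refine ⟨c, fun k l s p q h => ?_⟩
  have hck := hc k
  have hcl := hc l
  generalize c k = ck at h hck
  generalize c l = cl at h hcl
  obtain ⟨y, u⟩ := ck
  obtain ⟨z, w⟩ := cl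
  obtain ⟨h1, h2⟩ := Sigma.mk.inj h
  dsimp only at h1 h2 hck hcl
  subst h1
  have h3 := eq_of_heq h2
  rcases hck with ⟨hy, p', hu⟩ | ⟨hy, hk, hu⟩ <;> rcases hcl with ⟨hy', q', hw⟩ | ⟨hy', hl, hw⟩
  -- After cancelling the common power of `α` at the end, one path ends in `β` and the other in `α`.
  -- These have equal length and are different.
  · have key : ∀ (m m' : ℕ) (a b : Quiver.Path s y), m < m' →
        (a.comp (β ⟨y, hy⟩)).comp (loopPow (α ⟨y, hy⟩) m) ≠
        (b.comp (β ⟨y, hy⟩)).comp (loopPow (α ⟨y, hy⟩) m') := by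
      intro m m' a b hm hab
      obtain ⟨d, rfl⟩ := Nat.exists_eq_add_of_lt hm
      rw [show m + d + 1 = (d + 1) + m by ring, loopPow_add, ← Quiver.Path.comp_assoc,
        Quiver.Path.comp_inj_left, loopPow, ← Quiver.Path.comp_assoc,
        Quiver.Path.comp_inj (hlen ⟨y, hy⟩).symm] at hab
      exact hne ⟨y, hy⟩ hab.2.symm
    rw [hu, hw] at h3
    simp only [← Quiver.Path.comp_assoc] at h3
    rcases lt_trichotomy (n k) (n l) with hlt | heq | hlt
    · exact (key _ _ (p.comp p') (q.comp q') hlt h3).elim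
    · exact hn heq
    · exact (key _ _ (q.comp q') (p.comp p') hlt h3.symm).elim
  · exact (hy' hy).elim
  · exact (hy hy').elim
  · have := hf (hu.symm.trans hw)
    simpa using this

end Paths

/-! ### Coordinates, and operators given by partial injections -/

section PartialInjection

variable {ι : Type*}

open Classical in
theorem inner_single_one (a : ι) (f : ℓ²(ι, ℂ)) :
    ⟪(lp.single 2 a (1 : ℂ) : ℓ²(ι, ℂ)), f⟫_ℂ = f a := by
  rw [lp.inner_single_left]; simp

theorem adjoint_pushforward (g : ι → Option ι) (hg : PartialInjective g) :
    adjoint (pushforward g hg) = pullback g hg := by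
  rw [pushforward, ContinuousLinearMap.adjoint_adjoint]

open Classical in
theorem pullback_single_some {g : ι → Option ι} (hg : PartialInjective g) {a b : ι}
    (h : g a = some b) : pullback g hg (lp.single 2 b 1) = lp.single 2 a 1 := by
  ext c
  rw [pullback_apply]
  by_cases hc : c = a
  · subst hc; simp [h]
  · rw [lp.single_apply_ne _ _ _ hc]
    cases hgc : g c with
    | none => rfl
    | some d =>
      have : d ≠ b := fun hdb => hc (hg c a b (by rw [hgc, hdb]) h)
      simp [this]

open Classical in
theorem pullback_single_none {g : ι → Option ι} (hg : PartialInjective g) {b : ι}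
    (h : ∀ a, g a ≠ some b) : pullback g hg (lp.single 2 b 1) = 0 := by
  ext c
  rw [pullback_apply]
  cases hgc : g c with
  | none => rfl
  | some d =>
    have : d ≠ b := fun hdb => h c (by rw [hgc, hdb])
    simp [this]

end PartialInjection

section Fock

variable {V : Type u} [Quiver.{v} V]

theorem inner_basisVector (w : FreeSemigroupoid V) (f : FockSpace V) :
    ⟪basisVector w, f⟫_ℂ = f w := inner_single_one w f

theorem basisVector_self (w : FreeSemigroupoid V) : basisVector w w = 1 := by
  simp [basisVector]

theorem basisVector_ne {w u : FreeSemigroupoid V} (h : u ≠ w) : basisVector w u = 0 := by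
  simp [basisVector, h]

theorem norm_basisVector (w : FreeSemigroupoid V) : ‖basisVector w‖ = 1 := by
  classical
  rw [basisVector, lp.norm_single (by norm_num), norm_one]

theorem hasSum_basisVector (f : FockSpace V) :
    HasSum (fun w => f w • basisVector w) f := by
  classical
  have := lp.hasSum_single (p := 2) (by norm_num) f
  convert this using 2 with w
  rw [basisVector, ← lp.single_smul, smul_eq_mul, mul_one]

/-- A bounded operator that kills the basis components of `f` kills `f`. -/
theorem apply_eq_zero_of_components {F : Type*} [NormedAddCommGroup F] [NormedSpace ℂ F]
    (T : FockSpace V →L[ℂ] F) (f : FockSpace V)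
    (h : ∀ w, f w ≠ 0 → T (basisVector w) = 0) : T f = 0 := by
  have h1 := (hasSum_basisVector f).mapL T
  refine h1.unique ?_
  convert hasSum_zero with w
  by_cases hw : f w = 0
  · simp [hw]
  · simp [h w hw]

theorem operator_ext {F : Type*} [NormedAddCommGroup F] [NormedSpace ℂ F]
    {S T : FockSpace V →L[ℂ] F}
    (h : ∀ w, S (basisVector w) = T (basisVector w)) : S = T := by
  ext1 f
  rw [← sub_eq_zero, ← sub_apply]
  exact apply_eq_zero_of_components _ f fun w _ => by simp [h w]

/-! ### Right translations -/

/-- The length of a path, as a function on the free semigroupoid. -/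
def FreeSemigroupoid.length (w : FreeSemigroupoid V) : ℕ := w.path.length

/-- The vertex `x` as a path of length `0`. -/
def vertex (x : V) : FreeSemigroupoid V := ⟨x, x, Quiver.Path.nil⟩

open Classical in
/-- The partial map `v ↦ vw` ("first `w`, then `v`"), defined for those `v` with `s(v) = r(w)`. -/
def rightMul (w v : FreeSemigroupoid V) : Option (FreeSemigroupoid V) :=
  if h : v.source = w.range then some ⟨w.source, v.range, w.path.comp (h ▸ v.path)⟩ else none

theorem rightMul_mk {a b c : V} (p : Quiver.Path a b) (q : Quiver.Path b c) :
    rightMul ⟨a, b, p⟩ ⟨b, c, q⟩ = some ⟨a, c, p.comp q⟩ := by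
  simp [rightMul]

theorem rightMul_of_ne {w v : FreeSemigroupoid V} (h : v.source ≠ w.range) :
    rightMul w v = none := by
  simp [rightMul, h]

theorem rightMul_eq_some {a b : V} {p : Quiver.Path a b} {v u : FreeSemigroupoid V}
    (h : rightMul ⟨a, b, p⟩ v = some u) :
    ∃ (c : V) (q : Quiver.Path b c), v = ⟨b, c, q⟩ ∧ u = ⟨a, c, p.comp q⟩ := by
  obtain ⟨b', c, q⟩ := v
  by_cases hb : b' = b
  · subst hb
    rw [rightMul_mk] at h
    exact ⟨c, q, rfl, (Option.some.inj h).symm⟩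
  · rw [rightMul_of_ne hb] at h
    cases h

theorem rightMul_injective (w : FreeSemigroupoid V) : PartialInjective (rightMul w) := by
  obtain ⟨a, b, p⟩ := w
  intro v v' u h h'
  obtain ⟨c, q, rfl, rfl⟩ := rightMul_eq_some h
  obtain ⟨c', q', rfl, hu⟩ := rightMul_eq_some h'
  injection hu with _ h1 h2
  subst h1
  rw [Quiver.Path.comp_injective_right p (eq_of_heq h2)]

/-- The right translation `R_w`: `R_w ξ_v = ξ_{vw}` if `s(v) = r(w)`, and `0` otherwise. -/
def rightTranslation (w : FreeSemigroupoid V) : FockSpace V →L[ℂ] FockSpace V :=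
  pushforward (rightMul w) (rightMul_injective w)

theorem rightTranslation_basisVector {a b c : V} (p : Quiver.Path a b) (q : Quiver.Path b c) :
    rightTranslation ⟨a, b, p⟩ (basisVector ⟨b, c, q⟩) = basisVector ⟨a, c, p.comp q⟩ := by
  simp [rightTranslation, basisVector, pushforward_single, rightMul_mk]

theorem rightTranslation_basisVector_of_ne {w v : FreeSemigroupoid V} (h : v.source ≠ w.range) :
    rightTranslation w (basisVector v) = 0 := by
  simp [rightTranslation, basisVector, pushforward_single, rightMul_of_ne h]

theorem rightTranslation_vertex (w : FreeSemigroupoid V) :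
    rightTranslation w (basisVector (vertex w.range)) = basisVector w :=
  rightTranslation_basisVector w.path Quiver.Path.nil

theorem adjoint_rightTranslation_basisVector {a b c : V} (p : Quiver.Path a b)
    (q : Quiver.Path b c) :
    adjoint (rightTranslation ⟨a, b, p⟩) (basisVector ⟨a, c, p.comp q⟩) =
      basisVector ⟨b, c, q⟩ := by
  rw [rightTranslation, adjoint_pushforward]
  exact pullback_single_some _ (rightMul_mk p q)

theorem adjoint_rightTranslation_basisVector_of_ne {w u : FreeSemigroupoid V}
    (h : ∀ v, rightMul w v ≠ some u) : adjoint (rightTranslation w) (basisVector u) = 0 := by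
  rw [rightTranslation, adjoint_pushforward]
  exact pullback_single_none _ h

theorem adjoint_rightTranslation_apply {a b c : V} (p : Quiver.Path a b) (q : Quiver.Path b c)
    (f : FockSpace V) : adjoint (rightTranslation ⟨a, b, p⟩) f ⟨b, c, q⟩ = f ⟨a, c, p.comp q⟩ := by
  rw [rightTranslation, adjoint_pushforward, pullback_apply, rightMul_mk]
  rfl

theorem rightTranslation_mul {a b c : V} (p : Quiver.Path a b) (q : Quiver.Path b c) :
    rightTranslation ⟨a, b, p⟩ * rightTranslation ⟨b, c, q⟩ =
      rightTranslation ⟨a, c, p.comp q⟩ := by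
  refine operator_ext fun w => ?_
  obtain ⟨d, e, r⟩ := w
  rw [mul_apply_eq_comp]
  by_cases h : d = c
  · subst h
    simp only [rightTranslation_basisVector, Quiver.Path.comp_assoc]
  · rw [rightTranslation_basisVector_of_ne h, rightTranslation_basisVector_of_ne h, map_zero]

theorem adjoint_rightTranslation_mul_self (w : FreeSemigroupoid V) :
    adjoint (rightTranslation w) * rightTranslation w = rightTranslation (vertex w.range) := by
  obtain ⟨a, b, p⟩ := w
  refine operator_ext fun w => ?_
  obtain ⟨d, e, r⟩ := w
  rw [mul_apply_eq_comp]
  by_cases h : d = b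
  · subst h
    rw [rightTranslation_basisVector, adjoint_rightTranslation_basisVector, vertex,
      rightTranslation_basisVector, Quiver.Path.nil_comp]
  · rw [rightTranslation_basisVector_of_ne h, map_zero]
    exact (rightTranslation_basisVector_of_ne h).symm

theorem adjoint_rightTranslation_mul {a b c : V} (p : Quiver.Path a b) (q : Quiver.Path b c) :
    adjoint (rightTranslation ⟨a, b, p⟩) * rightTranslation ⟨a, c, p.comp q⟩ =
      rightTranslation ⟨b, c, q⟩ := by
  rw [← rightTranslation_mul, ← mul_assoc, adjoint_rightTranslation_mul_self, vertex,
    rightTranslation_mul, Quiver.Path.nil_comp]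

theorem adjoint_rightTranslation_vertex (x : V) :
    adjoint (rightTranslation (vertex x)) = rightTranslation (vertex x) := by
  have h := adjoint_rightTranslation_mul_self (vertex x)
  change _ = rightTranslation (vertex x) at h
  rw [← h]
  exact IsSelfAdjoint.star_mul_self (rightTranslation (vertex x))

/-- The ranges of `R_v` and `R_w` are orthogonal unless one of `v`, `w` is an initial segment of the
other. -/
theorem adjoint_rightTranslation_mul_cases (v w : FreeSemigroupoid V)
    (hl : v.length ≤ w.length) :
    adjoint (rightTranslation v) * rightTranslation w = 0 ∨
    ∃ (a b c : V) (p : Quiver.Path a b) (q : Quiver.Path b c),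
      v = ⟨a, b, p⟩ ∧ w = ⟨a, c, p.comp q⟩ := by
  by_cases h : ∃ s t u, rightMul v s = some u ∧ rightMul w t = some u
  · right
    obtain ⟨s, t, u, hs, ht⟩ := h
    obtain ⟨a, b, p⟩ := v
    obtain ⟨a', b', p'⟩ := w
    obtain ⟨c, q, rfl, rfl⟩ := rightMul_eq_some hs
    obtain ⟨c', q', rfl, hu⟩ := rightMul_eq_some ht
    injection hu with h1 h2 h3
    subst h1 h2
    obtain ⟨r, rfl, -⟩ := exists_comp_eq_of_comp_eq (eq_of_heq h3) hl
    exact ⟨a, b, b', p, r, rfl, rfl⟩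
  · left
    push Not at h
    refine operator_ext fun u => ?_
    rw [mul_apply_eq_comp, zero_apply]
    cases hu : rightMul w u with
    | none =>
      have : rightTranslation w (basisVector u) = 0 := by
        simp [rightTranslation, basisVector, pushforward_single, hu]
      rw [this, map_zero]
    | some x =>
      have : rightTranslation w (basisVector u) = basisVector x := by
        simp [rightTranslation, basisVector, pushforward_single, hu]
      rw [this]
      exact adjoint_rightTranslation_basisVector_of_ne fun s hs => h s u x hs hu

/-! ### The commutant of the right translations -/

theorem pushforward_basisVector {g : FreeSemigroupoid V → Option (FreeSemigroupoid V)}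
    (hg : PartialInjective g) (w : FreeSemigroupoid V) :
    pushforward g hg (basisVector w) = (g w).elim 0 basisVector :=
  pushforward_single g hg w

theorem pushforward_elim {g : FreeSemigroupoid V → Option (FreeSemigroupoid V)}
    (hg : PartialInjective g) (o : Option (FreeSemigroupoid V)) :
    pushforward g hg (o.elim 0 basisVector) = (o.bind g).elim 0 basisVector := by
  cases o with
  | none => simp
  | some w => exact pushforward_basisVector hg w

variable (V) in
/-- The commutant of the right translations. -/
def rightCommutant : Subalgebra ℂ (FockSpace V →L[ℂ] FockSpace V) :=
  Subalgebra.centralizer ℂ (Set.range rightTranslation)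

theorem mem_rightCommutant {T : FockSpace V →L[ℂ] FockSpace V} :
    T ∈ rightCommutant V ↔ ∀ w, rightTranslation w * T = T * rightTranslation w := by
  simp [rightCommutant, Subalgebra.mem_centralizer_iff]

/-- An operator given by a partial injection that commutes with the partial maps `v ↦ vw` lies in
the commutant of the right translations. -/
theorem pushforward_mem_rightCommutant {g : FreeSemigroupoid V → Option (FreeSemigroupoid V)}
    (hg : PartialInjective g)
    (h : ∀ w v, (g v).bind (rightMul w) = (rightMul w v).bind g) :
    pushforward g hg ∈ rightCommutant V := by
  rw [mem_rightCommutant]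
  intro w
  refine operator_ext fun v => ?_
  rw [mul_apply_eq_comp, mul_apply_eq_comp, rightTranslation, pushforward_basisVector,
    pushforward_basisVector, pushforward_elim, pushforward_elim, h]

theorem rightMul_extend_comm {a b : V} (e : a ⟶ b) (w v : FreeSemigroupoid V) :
    (extend e v).bind (rightMul w) = (rightMul w v).bind (extend e) := by
  obtain ⟨x, y, p⟩ := w
  obtain ⟨y', z, q⟩ := v
  by_cases h : y' = y <;> by_cases h' : z = a
  · subst h h'
    simp [extend, rightMul]
  · subst h
    simp [extend, rightMul, h']
  · subst h'
    simp [extend, rightMul, h]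
  · simp [extend, rightMul, h, h']

theorem rightMul_restrict_comm (x : V) (w v : FreeSemigroupoid V) :
    (restrict x v).bind (rightMul w) = (rightMul w v).bind (restrict x) := by
  obtain ⟨a, y, p⟩ := w
  obtain ⟨y', z, q⟩ := v
  by_cases h : y' = y <;> by_cases h' : z = x
  · subst h h'
    simp [restrict, rightMul]
  · subst h
    simp [restrict, rightMul, h']
  · subst h'
    simp [restrict, rightMul, h]
  · simp [restrict, rightMul, h, h']

theorem creation_mem_rightCommutant {a b : V} (e : a ⟶ b) : creation e ∈ rightCommutant V :=
  pushforward_mem_rightCommutant _ (rightMul_extend_comm e)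

theorem vertexProjection_mem_rightCommutant (x : V) : vertexProjection x ∈ rightCommutant V :=
  pushforward_mem_rightCommutant _ (rightMul_restrict_comm x)

/-- A centralizer is a norm-closed algebra, so it suffices to look at the generators. -/
theorem quiverAlgebra_subset_rightCommutant {T : FockSpace V →L[ℂ] FockSpace V}
    (hT : T ∈ quiverAlgebra V) : T ∈ rightCommutant V := by
  have h1 : NonUnitalAlgebra.adjoin ℂ (generators V) ≤
      (rightCommutant V).toNonUnitalSubalgebra := by
    rw [NonUnitalAlgebra.adjoin_le_iff]
    rintro T (⟨a, b, e, rfl⟩ | ⟨x, rfl⟩)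
    · exact creation_mem_rightCommutant e
    · exact vertexProjection_mem_rightCommutant x
  have h2 : IsClosed ((rightCommutant V : Set (FockSpace V →L[ℂ] FockSpace V))) :=
    Set.isClosed_centralizer _
  exact h2.closure_subset_iff.2 h1 hT

/-- The free semigroupoid algebra is contained in the commutant of the right translations. -/
theorem freeSemigroupoidAlgebra_subset_rightCommutant {T : FockSpace V →L[ℂ] FockSpace V}
    (hT : T ∈ freeSemigroupoidAlgebra V) : T ∈ rightCommutant V := by
  rw [mem_rightCommutant]
  intro w
  ext1 f
  refine ext_inner_left ℂ fun g => ?_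
  simp only [mul_apply_eq_comp]
  rw [← ContinuousLinearMap.adjoint_inner_left]
  let P : (FockSpace V →WOT[ℂ] FockSpace V) → Prop := fun S =>
    ⟪adjoint (rightTranslation w) g, S f⟫_ℂ = ⟪g, S (rightTranslation w f)⟫_ℂ
  have hc : ∀ x y : FockSpace V,
      Continuous fun S : FockSpace V →WOT[ℂ] FockSpace V => ⟪y, S x⟫_ℂ := fun x y =>
    ContinuousLinearMapWOT.continuous_iff.1 continuous_id x y
  have hP : IsClosed {S | P S} := isClosed_eq (hc _ _) (hc _ _)
  refine hP.closure_subset_iff.2 ?_ hT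
  rintro _ ⟨S, hS, rfl⟩
  have := congrArg (fun X => ⟪g, X f⟫_ℂ)
    (mem_rightCommutant.1 (quiverAlgebra_subset_rightCommutant hS) w)
  simp only [mul_apply_eq_comp] at this
  rw [← ContinuousLinearMap.adjoint_inner_left] at this
  exact this

/-- The $\varepsilon/2$ argument: a uniform bound upgrades convergence on a total set to convergence
everywhere. -/
theorem tendsto_apply_zero_of_basisVector {κ : Type*} {l : Filter κ}
    {φ : κ → FockSpace V →L[ℂ] ℂ} {C : ℝ} (hφ : ∀ᶠ i in l, ‖φ i‖ ≤ C)
    (h : ∀ w, Filter.Tendsto (fun i => φ i (basisVector w)) l (nhds 0)) (f : FockSpace V) :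
    Filter.Tendsto (fun i => φ i f) l (nhds 0) := by
  rw [Metric.tendsto_nhds]
  intro ε hε
  have hC : 0 < |C| + 1 := by positivity
  obtain ⟨s, hs⟩ := ((Metric.tendsto_nhds.1 (hasSum_basisVector f)) (ε / 2 / (|C| + 1))
    (by positivity)).exists
  have h1 : Filter.Tendsto (fun i => φ i (∑ w ∈ s, f w • basisVector w)) l (nhds 0) := by
    have : Filter.Tendsto (fun i => ∑ w ∈ s, f w • φ i (basisVector w)) l
        (nhds (∑ w ∈ s, f w • (0 : ℂ))) := tendsto_finsetSum _ fun w _ => (h w).const_smul _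
    simpa using this
  filter_upwards [hφ, (Metric.tendsto_nhds.1 h1) (ε / 2) (by positivity)] with i hi hi'
  rw [dist_zero_right] at hi' ⊢
  rw [dist_comm, dist_eq_norm, lt_div_iff₀ hC] at hs
  have h2 : φ i f = φ i (∑ w ∈ s, f w • basisVector w) +
      φ i (f - ∑ w ∈ s, f w • basisVector w) := by rw [← map_add]; simp
  have h3 : ‖φ i (f - ∑ w ∈ s, f w • basisVector w)‖ ≤
      ‖f - ∑ w ∈ s, f w • basisVector w‖ * (|C| + 1) := by
    refine ((φ i).le_opNorm _).trans ?_
    rw [mul_comm]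
    gcongr
    linarith [le_abs_self C]
  rw [h2]
  refine (norm_add_le _ _).trans_lt ?_
  linarith

/-- The free semigroupoid algebra is closed under bounded limits of matrix coefficients. -/
theorem mem_freeSemigroupoidAlgebra_of_tendsto {κ : Type*} {l : Filter κ} [l.NeBot]
    {B : κ → FockSpace V →L[ℂ] FockSpace V} {T : FockSpace V →L[ℂ] FockSpace V} {C : ℝ}
    (hB : ∀ᶠ i in l, B i ∈ quiverAlgebra V ∧ ‖B i‖ ≤ C)
    (h : ∀ w u, Filter.Tendsto (fun i => B i (basisVector w) u) l (nhds (T (basisVector w) u))) :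
    T ∈ freeSemigroupoidAlgebra V := by
  have hD : ∀ᶠ i in l, ‖B i - T‖ ≤ C + ‖T‖ := hB.mono fun i hi =>
    (norm_sub_le _ _).trans (by linarith [hi.2])
  -- Density is used twice: here to free the right-hand vector of the matrix coefficient, and in
  -- `h2` to free the left-hand one.
  have h1 : ∀ f u, Filter.Tendsto (fun i => (B i - T) f u) l (nhds 0) := by
    intro f u
    have := tendsto_apply_zero_of_basisVector (l := l) (C := C + ‖T‖)
      (φ := fun i => (innerSL ℂ (basisVector u)).comp (B i - T)) ?_ ?_ f
    · simpa only [ContinuousLinearMap.comp_apply, innerSL_apply_apply, inner_basisVector] using this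
    · filter_upwards [hD] with i hi
      refine (ContinuousLinearMap.opNorm_comp_le _ _).trans ?_
      rw [innerSL_apply_norm, norm_basisVector, one_mul]
      exact hi
    · intro w
      simp only [ContinuousLinearMap.comp_apply, innerSL_apply_apply, inner_basisVector]
      have := (h w u).sub_const (T (basisVector w) u)
      rw [sub_self] at this
      exact this
  refine mem_closure_of_tendsto (f := fun i => ContinuousLinearMapWOT.ofCLM (B i)) (b := l)
    ?_ (hB.mono fun i hi => ⟨B i, hi.1, rfl⟩)
  rw [ContinuousLinearMapWOT.tendsto_iff_forall_inner_apply_tendsto]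
  intro f g
  have h2 := tendsto_apply_zero_of_basisVector (l := l) (C := (C + ‖T‖) * ‖f‖)
      (φ := fun i => innerSL ℂ ((B i - T) f)) ?_ ?_ g
  · have h3 := (Complex.continuous_conj.tendsto 0).comp h2
    simp only [Function.comp_def, innerSL_apply_apply, inner_conj_symm, map_zero] at h3
    have h4 := h3.add_const ⟪g, T f⟫_ℂ
    simp only [sub_apply, inner_sub_right, sub_add_cancel, zero_add] at h4
    exact h4
  · filter_upwards [hD] with i hi
    rw [innerSL_apply_norm]
    exact (ContinuousLinearMap.le_opNorm _ _).trans (by gcongr)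
  · intro u
    have h3 := (Complex.continuous_conj.tendsto 0).comp (h1 f u)
    simpa only [Function.comp_def, innerSL_apply_apply, ← inner_basisVector, inner_conj_symm,
      map_zero] using h3

end Fock

/-! ### Rows of contractions with orthogonal ranges -/

section OrthogonalRanges

variable {H ι : Type*} [NormedAddCommGroup H] [InnerProductSpace ℂ H] [CompleteSpace H]

theorem norm_sum_smul_sq_le {T : ι → H →L[ℂ] H} (hT : ∀ i, ‖T i‖ ≤ 1)
    (horth : ∀ i j, i ≠ j → adjoint (T i) * T j = 0) (a : ι → ℂ) (s : Finset ι) :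
    ‖∑ i ∈ s, a i • T i‖ ^ 2 ≤ ∑ i ∈ s, ‖a i‖ ^ 2 := by
  classical
  have key : ∀ (f : H) (s : Finset ι), ‖∑ i ∈ s, a i • T i f‖ ^ 2 ≤ (∑ i ∈ s, ‖a i‖ ^ 2) * ‖f‖ ^ 2 := by
    intro f s
    induction s using Finset.induction_on with
    | empty => simp
    | insert i s hi ih =>
      have h0 : ⟪a i • T i f, ∑ j ∈ s, a j • T j f⟫_ℂ = 0 := by
        rw [inner_sum]
        refine Finset.sum_eq_zero fun j hj => ?_
        have hij : i ≠ j := fun h => hi (h ▸ hj)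
        rw [inner_smul_left, inner_smul_right, ← ContinuousLinearMap.adjoint_inner_right,
          ← mul_apply_eq_comp, horth i j hij]
        simp
      have h1 := norm_add_sq_eq_norm_sq_add_norm_sq_of_inner_eq_zero _ _ h0
      rw [Finset.sum_insert hi, Finset.sum_insert hi, sq, h1, add_mul]
      refine add_le_add ?_ (by rw [← sq]; exact ih)
      rw [← sq, norm_smul, mul_pow]
      gcongr
      simpa using (T i).le_of_opNorm_le (hT i) f
  have h2 : ‖∑ i ∈ s, a i • T i‖ ≤ √(∑ i ∈ s, ‖a i‖ ^ 2) := by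
    refine ContinuousLinearMap.opNorm_le_bound _ (Real.sqrt_nonneg _) fun f => ?_
    have := Real.sqrt_le_sqrt (key f s)
    rw [Real.sqrt_sq (norm_nonneg _), Real.sqrt_mul' _ (sq_nonneg _),
      Real.sqrt_sq (norm_nonneg _)] at this
    simpa [sum_apply] using this
  calc _ ≤ √(∑ i ∈ s, ‖a i‖ ^ 2) ^ 2 := by gcongr
    _ = _ := Real.sq_sqrt (by positivity)

/-- A row of contractions with orthogonal ranges and square summable coefficients converges in
norm. -/
theorem summable_smul_of_orthogonal {T : ι → H →L[ℂ] H} (hT : ∀ i, ‖T i‖ ≤ 1)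
    (horth : ∀ i j, i ≠ j → adjoint (T i) * T j = 0) {a : ι → ℂ}
    (ha : Summable fun i => ‖a i‖ ^ 2) : Summable fun i => a i • T i := by
  rw [summable_iff_vanishing_norm]
  intro ε hε
  obtain ⟨s, hs⟩ := summable_iff_vanishing_norm.1 ha (ε ^ 2) (by positivity)
  refine ⟨s, fun t ht => ?_⟩
  have h1 := (norm_sum_smul_sq_le hT horth a t).trans_lt ((le_abs_self _).trans_lt (hs t ht))
  exact lt_of_pow_lt_pow_left₀ 2 hε.le h1

theorem norm_tsum_smul_sq_le {T : ι → H →L[ℂ] H} (hT : ∀ i, ‖T i‖ ≤ 1)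
    (horth : ∀ i j, i ≠ j → adjoint (T i) * T j = 0) {a : ι → ℂ}
    (ha : Summable fun i => ‖a i‖ ^ 2) : ‖∑' i, a i • T i‖ ^ 2 ≤ ∑' i, ‖a i‖ ^ 2 :=
  le_of_tendsto_of_tendsto' ((summable_smul_of_orthogonal hT horth ha).hasSum.norm.pow 2)
    ha.hasSum (norm_sum_smul_sq_le hT horth a)

end OrthogonalRanges

section Fock

variable {V : Type u} [Quiver.{v} V]

theorem norm_pushforward_le {ι : Type*} (g : ι → Option ι) (hg : PartialInjective g) :
    ‖pushforward g hg‖ ≤ 1 := by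
  rw [pushforward, LinearIsometryEquiv.norm_map]
  exact LinearMap.mkContinuous_norm_le _ zero_le_one _

/-! ### Left translations -/

theorem leftMul_injective (v : FreeSemigroupoid V) :
    PartialInjective fun w => rightMul w v := by
  rintro ⟨a, b, p⟩ ⟨a', b', p'⟩ u h h'
  obtain ⟨c, q, rfl, rfl⟩ := rightMul_eq_some h
  obtain ⟨c', q', hv, hu⟩ := rightMul_eq_some h'
  injection hv with h1 h2 h3
  subst h1 h2
  injection hu with h4 h5 h6
  subst h4
  have h7 := eq_of_heq h6
  rw [← eq_of_heq h3, Quiver.Path.comp_inj_left] at h7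
  rw [h7]

/-- The left translation `L_v`: `L_v ξ_w = ξ_{vw}` if `r(w) = s(v)`, and `0` otherwise. -/
def leftTranslation (v : FreeSemigroupoid V) : FockSpace V →L[ℂ] FockSpace V :=
  pushforward (fun w => rightMul w v) (leftMul_injective v)

theorem leftTranslation_basisVector (v w : FreeSemigroupoid V) :
    leftTranslation v (basisVector w) = rightTranslation w (basisVector v) := by
  rw [leftTranslation, rightTranslation, pushforward_basisVector, pushforward_basisVector]

theorem leftTranslation_vertex (x : V) : leftTranslation (vertex x) = vertexProjection x := by
  refine operator_ext fun w => ?_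
  obtain ⟨c, d, q⟩ := w
  rw [leftTranslation_basisVector]
  by_cases h : d = x
  · subst h
    rw [vertex, rightTranslation_basisVector]
    exact (vertexProjection_basisVector _).symm
  · rw [rightTranslation_basisVector_of_ne (Ne.symm h)]
    exact (vertexProjection_basisVector_of_ne _ _ h).symm

theorem leftTranslation_cons {a b c : V} (p : Quiver.Path a b) (e : b ⟶ c) :
    leftTranslation ⟨a, c, p.cons e⟩ = creation e * leftTranslation ⟨a, b, p⟩ := by
  refine operator_ext fun w => ?_
  obtain ⟨c, d, q⟩ := w
  rw [mul_apply_eq_comp, leftTranslation_basisVector, leftTranslation_basisVector]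
  by_cases h : a = d
  · subst h
    rw [rightTranslation_basisVector, rightTranslation_basisVector, creation_basisVector,
      Quiver.Path.comp_cons]
  · rw [rightTranslation_basisVector_of_ne h, rightTranslation_basisVector_of_ne h, map_zero]

theorem leftTranslation_mem_adjoin (v : FreeSemigroupoid V) :
    leftTranslation v ∈ NonUnitalAlgebra.adjoin ℂ (generators V) := by
  obtain ⟨a, b, p⟩ := v
  induction p with
  | nil =>
    have h : vertexProjection a ∈ NonUnitalAlgebra.adjoin ℂ (generators V) :=
      NonUnitalAlgebra.subset_adjoin ℂ (Or.inr ⟨a, rfl⟩)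
    rwa [← leftTranslation_vertex] at h
  | cons p e ih =>
    have h : creation e ∈ NonUnitalAlgebra.adjoin ℂ (generators V) :=
      NonUnitalAlgebra.subset_adjoin ℂ (Or.inl ⟨_, _, e, rfl⟩)
    rw [leftTranslation_cons]
    exact mul_mem h ih

theorem leftTranslation_mem (v : FreeSemigroupoid V) : leftTranslation v ∈ quiverAlgebra V :=
  subset_closure (leftTranslation_mem_adjoin v)

/-- A path has only one terminal segment of a given length, so the two ranges are spanned by
disjoint sets of basis vectors. -/
theorem adjoint_leftTranslation_mul {v v' : FreeSemigroupoid V} (hl : v.length = v'.length)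
    (hne : v ≠ v') : adjoint (leftTranslation v) * leftTranslation v' = 0 := by
  refine operator_ext fun w => ?_
  rw [mul_apply_eq_comp, zero_apply, leftTranslation, leftTranslation, adjoint_pushforward,
    pushforward_basisVector]
  cases hu : rightMul w v' with
  | none => exact map_zero _
  | some u =>
    refine pullback_single_none _ fun t ht => hne ?_
    obtain ⟨a, b, p⟩ := w
    obtain ⟨a', b', p'⟩ := t
    obtain ⟨c, q, rfl, rfl⟩ := rightMul_eq_some hu
    obtain ⟨c', q', rfl, hu'⟩ := rightMul_eq_some ht
    injection hu' with h1 h2 h3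
    subst h1 h2
    have h4 := eq_of_heq h3
    have h5 := congrArg Quiver.Path.length h4
    change q'.length = q.length at hl
    simp only [Quiver.Path.length_comp] at h5
    obtain ⟨r, hr, hr'⟩ := exists_comp_eq_of_comp_eq h4 (by omega)
    have h6 := congrArg Quiver.Path.length hr'
    rw [Quiver.Path.length_comp] at h6
    have h7 : r.length = 0 := by omega
    obtain rfl := Quiver.Path.eq_of_length_zero r h7
    obtain rfl := Quiver.Path.eq_nil_of_length_zero r h7
    rw [hr', Quiver.Path.nil_comp]

/-! ### Fourier expansion of the operators that commute with the right translations -/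

variable {T : FockSpace V →L[ℂ] FockSpace V}

/-- Since $\xi_w=R_w\xi_{r(w)}$, an operator in the commutant is determined by its values at the
vertices. This is the source of the Fourier expansion. -/
theorem apply_basisVector_of_mem_rightCommutant (hT : T ∈ rightCommutant V)
    (w : FreeSemigroupoid V) :
    T (basisVector w) = rightTranslation w (T (basisVector (vertex w.range))) := by
  rw [← mul_apply_eq_comp, mem_rightCommutant.1 hT, mul_apply_eq_comp, rightTranslation_vertex]

theorem rightTranslation_apply {a b c : V} (p : Quiver.Path a b) (q : Quiver.Path b c)
    (f : FockSpace V) : rightTranslation ⟨a, b, p⟩ f ⟨a, c, p.comp q⟩ = f ⟨b, c, q⟩ := by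
  rw [← inner_basisVector, ← ContinuousLinearMap.adjoint_inner_left,
    adjoint_rightTranslation_basisVector, inner_basisVector]

theorem rightTranslation_apply_of_ne {w u : FreeSemigroupoid V}
    (h : ∀ v, rightMul w v ≠ some u) (f : FockSpace V) : rightTranslation w f u = 0 := by
  rw [← inner_basisVector, ← ContinuousLinearMap.adjoint_inner_left,
    adjoint_rightTranslation_basisVector_of_ne h, inner_zero_left]

theorem apply_basisVector_apply_of_length_lt (hT : T ∈ rightCommutant V)
    {w u : FreeSemigroupoid V} (h : u.length < w.length) : T (basisVector w) u = 0 := by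
  rw [apply_basisVector_of_mem_rightCommutant hT]
  refine rightTranslation_apply_of_ne (fun v hv => ?_) _
  obtain ⟨a, b, p⟩ := w
  obtain ⟨c, q, rfl, rfl⟩ := rightMul_eq_some hv
  simp only [FreeSemigroupoid.length, Quiver.Path.length_comp] at h
  omega

/-- The paths of length `n` with source `x`. -/
abbrev Slice (x : V) (n : ℕ) := {v : FreeSemigroupoid V // v.source = x ∧ v.length = n}

theorem summable_slice (f : FockSpace V) (x : V) (n : ℕ) :
    Summable fun v : Slice x n => ‖f v.1‖ ^ 2 := by
  have h := (lp.memℓp f).summable (by norm_num)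
  norm_num at h
  exact h.comp_injective Subtype.val_injective

theorem tsum_slice_le (f : FockSpace V) (x : V) (n : ℕ) :
    ∑' v : Slice x n, ‖f v.1‖ ^ 2 ≤ ‖f‖ ^ 2 := by
  have h := (lp.memℓp f).summable (by norm_num)
  have h' := lp.norm_rpow_eq_tsum (p := 2) (by norm_num) f
  norm_num at h h'
  rw [h']
  exact h.tsum_subtype_le _ _ (fun _ => by positivity)

variable (T) in
/-- The part of degree `n` of `T P_x`. -/
def fourierCoeff (x : V) (n : ℕ) : FockSpace V →L[ℂ] FockSpace V :=
  ∑' v : Slice x n, T (basisVector (vertex x)) v.1 • leftTranslation v.1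

theorem hasSum_fourierCoeff (x : V) (n : ℕ) :
    HasSum (fun v : Slice x n => T (basisVector (vertex x)) v.1 • leftTranslation v.1)
      (fourierCoeff T x n) :=
  (summable_smul_of_orthogonal (fun _ => norm_pushforward_le _ _)
    (fun i j hij => adjoint_leftTranslation_mul (i.2.2.trans j.2.2.symm)
      fun h => hij (Subtype.ext h)) (summable_slice _ x n)).hasSum

/-- The left translations by paths of one length form a row with orthogonal ranges, so the norm is
at most the $\ell^2$ norm of the coefficients, which are coordinates of $T\xi_x$. Uniformity in $n$
makes the Abel series converge in norm. -/
theorem norm_fourierCoeff_le (x : V) (n : ℕ) : ‖fourierCoeff T x n‖ ≤ ‖T‖ := by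
  have h1 := norm_tsum_smul_sq_le (T := fun v : Slice x n => leftTranslation v.1)
    (fun _ => norm_pushforward_le _ _)
    (fun i j hij => adjoint_leftTranslation_mul (i.2.2.trans j.2.2.symm)
      fun h => hij (Subtype.ext h)) (summable_slice (T (basisVector (vertex x))) x n)
  have h2 := h1.trans (tsum_slice_le _ x n)
  have h3 := T.le_opNorm (basisVector (vertex x))
  rw [norm_basisVector, mul_one] at h3
  exact (le_of_sq_le_sq h2 (norm_nonneg _)).trans h3

theorem isClosed_quiverAlgebra :
    IsClosed (quiverAlgebra V : Set (FockSpace V →L[ℂ] FockSpace V)) := isClosed_closure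

theorem hasSum_mem_quiverAlgebra {κ : Type*} {f : κ → FockSpace V →L[ℂ] FockSpace V}
    {S : FockSpace V →L[ℂ] FockSpace V} (h : HasSum f S) (hf : ∀ i, f i ∈ quiverAlgebra V) :
    S ∈ quiverAlgebra V :=
  isClosed_quiverAlgebra.mem_of_tendsto h (Filter.Eventually.of_forall fun _ =>
    sum_mem fun i _ => hf i)

theorem fourierCoeff_mem (x : V) (n : ℕ) : fourierCoeff T x n ∈ quiverAlgebra V :=
  hasSum_mem_quiverAlgebra (hasSum_fourierCoeff x n) fun v =>
    SMulMemClass.smul_mem _ (leftTranslation_mem v.1)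

theorem hasSum_apply_apply {κ : Type*} {f : κ → FockSpace V →L[ℂ] FockSpace V}
    {S : FockSpace V →L[ℂ] FockSpace V} (h : HasSum f S) (g : FockSpace V)
    (u : FreeSemigroupoid V) : HasSum (fun i => f i g u) (S g u) := by
  have h1 := (h.mapL (ContinuousLinearMap.apply ℂ (FockSpace V) g)).mapL
    (innerSL ℂ (basisVector u))
  simpa only [ContinuousLinearMap.apply_apply, innerSL_apply_apply, inner_basisVector] using h1

open Classical in
theorem fourierCoeff_basisVector_apply (hT : T ∈ rightCommutant V) (x : V) (n : ℕ)
    (w u : FreeSemigroupoid V) : fourierCoeff T x n (basisVector w) u =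
      if w.range = x ∧ w.length + n = u.length then T (basisVector w) u else 0 := by
  have h := hasSum_apply_apply (hasSum_fourierCoeff (T := T) x n) (basisVector w) u
  refine h.unique ?_
  simp only [smul_apply, leftTranslation_basisVector, lp.coeFn_smul,
    Pi.smul_apply, smul_eq_mul]
  by_cases hu : ∃ v, rightMul w v = some u
  · obtain ⟨v, hv⟩ := hu
    obtain ⟨a, b, p⟩ := w
    obtain ⟨c, q, rfl, rfl⟩ := rightMul_eq_some hv
    rw [apply_basisVector_of_mem_rightCommutant hT ⟨a, b, p⟩]
    simp only [rightTranslation_apply, FreeSemigroupoid.length, Quiver.Path.length_comp,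
      add_right_inj]
    split_ifs with hb
    · obtain ⟨rfl, rfl⟩ := hb
      have := hasSum_single (f := fun v : Slice b q.length =>
        T (basisVector (vertex b)) v.1 * basisVector v.1 ⟨b, c, q⟩) ⟨⟨b, c, q⟩, rfl, rfl⟩
        (fun v hv => by
          rw [basisVector_ne (fun h => hv (Subtype.ext h.symm)), mul_zero])
      simpa only [basisVector_self, mul_one] using this
    · convert hasSum_zero with v
      rw [basisVector_ne, mul_zero]
      rintro h
      have h2 := v.2
      rw [← h] at h2
      exact hb ⟨h2.1, h2.2.symm⟩
  · push Not at hu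
    rw [apply_basisVector_of_mem_rightCommutant hT w]
    simp only [rightTranslation_apply_of_ne hu, mul_zero, ite_self]
    exact hasSum_zero

/-! ### Abel means and the commutant theorem -/

variable (T) in
/-- The Abel means of the Fourier expansion of `T`, restricted to the paths with range in `F`. -/
def abelMean (z : ℂ) (F : Finset V) : FockSpace V →L[ℂ] FockSpace V :=
  ∑ x ∈ F, ∑' n : ℕ, z ^ n • fourierCoeff T x n

theorem hasSum_abelMean {z : ℂ} (hz : ‖z‖ < 1) (x : V) :
    HasSum (fun n : ℕ => z ^ n • fourierCoeff T x n) (∑' n : ℕ, z ^ n • fourierCoeff T x n) := by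
  refine (Summable.of_norm_bounded (g := fun n => ‖z‖ ^ n * ‖T‖) ?_ fun n => ?_).hasSum
  · exact (summable_geometric_of_lt_one (norm_nonneg _) hz).mul_right _
  · rw [norm_smul, norm_pow]
    gcongr
    exact norm_fourierCoeff_le x n

theorem abelMean_mem {z : ℂ} (hz : ‖z‖ < 1) (F : Finset V) : abelMean T z F ∈ quiverAlgebra V :=
  sum_mem fun x _ => hasSum_mem_quiverAlgebra (hasSum_abelMean hz x) fun n =>
    SMulMemClass.smul_mem _ (fourierCoeff_mem x n)

open Classical in
theorem abelMean_basisVector_apply (hT : T ∈ rightCommutant V) {z : ℂ} (hz : ‖z‖ < 1)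
    (F : Finset V) (w u : FreeSemigroupoid V) : abelMean T z F (basisVector w) u =
      (if w.range ∈ F then 1 else 0) * z ^ (u.length - w.length) * T (basisVector w) u := by
  have h1 : ∀ x, (∑' n : ℕ, z ^ n • fourierCoeff T x n) (basisVector w) u =
      if w.range = x then z ^ (u.length - w.length) * T (basisVector w) u else 0 := by
    intro x
    refine (hasSum_apply_apply (hasSum_abelMean (T := T) hz x) (basisVector w) u).unique ?_
    simp only [smul_apply, lp.coeFn_smul, Pi.smul_apply, smul_eq_mul,
      fourierCoeff_basisVector_apply hT]
    split_ifs with hx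
    · rcases lt_or_ge u.length w.length with hlt | hle
      · simp only [apply_basisVector_apply_of_length_lt hT hlt, ite_self, mul_zero]
        exact hasSum_zero
      · have := hasSum_single (f := fun n : ℕ => z ^ n *
          if w.range = x ∧ w.length + n = u.length then T (basisVector w) u else 0)
          (u.length - w.length) (fun n hn => by
            rw [if_neg (fun h => hn (by omega)), mul_zero])
        rwa [if_pos ⟨hx, by omega⟩] at this
    · simp only [hx, false_and, if_false, mul_zero]
      exact hasSum_zero
  rw [abelMean, sum_apply, lp.coeFn_sum, Finset.sum_apply]
  simp only [h1, Finset.sum_ite_eq]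
  split_ifs <;> simp

theorem norm_sum_smul_basisVector_le {c d : FreeSemigroupoid V → ℂ} (h : ∀ w, ‖c w‖ ≤ ‖d w‖)
    (s : Finset (FreeSemigroupoid V)) :
    ‖∑ w ∈ s, c w • basisVector w‖ ≤ ‖∑ w ∈ s, d w • basisVector w‖ := by
  classical
  have key : ∀ c : FreeSemigroupoid V → ℂ,
      ‖∑ w ∈ s, c w • basisVector w‖ ^ 2 = ∑ w ∈ s, ‖c w‖ ^ 2 := by
    intro c
    have := lp.norm_sum_single (E := fun _ : FreeSemigroupoid V => ℂ) (p := 2) (by norm_num) c s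
    norm_num at this
    rw [← this]
    congr 2
    refine Finset.sum_congr rfl fun w _ => ?_
    rw [basisVector, ← lp.single_smul, smul_eq_mul, mul_one]
  refine le_of_sq_le_sq ?_ (norm_nonneg _)
  rw [key, key]
  gcongr with w
  exact h w

/-- On finite sums the form is a polynomial in $z$. On the unit circle it is a matrix coefficient of
$T$ itself, after the gauge unitaries $\xi_w\mapsto\zeta^{|w|}\xi_w$ and the projection onto ranges
in $F$ are moved to the vectors. The maximum principle extends the bound to the disc. -/
theorem norm_inner_abelMean_sum_le (hT : T ∈ rightCommutant V) {z : ℂ} (hz : ‖z‖ < 1)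
    (F : Finset V) (c d : FreeSemigroupoid V → ℂ) (s t : Finset (FreeSemigroupoid V)) :
    ‖⟪∑ u ∈ t, d u • basisVector u, abelMean T z F (∑ w ∈ s, c w • basisVector w)⟫_ℂ‖ ≤
      ‖T‖ * ‖∑ w ∈ s, c w • basisVector w‖ * ‖∑ u ∈ t, d u • basisVector u‖ := by
  classical
  let p : ℂ → ℂ := fun z => ∑ w ∈ s, ∑ u ∈ t, (starRingEnd ℂ (d u) * c w) *
    ((if w.range ∈ F then 1 else 0) * z ^ (u.length - w.length) * T (basisVector w) u)
  have hp : ∀ S : FockSpace V →L[ℂ] FockSpace V, ∀ c d : FreeSemigroupoid V → ℂ,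
      ⟪∑ u ∈ t, d u • basisVector u, S (∑ w ∈ s, c w • basisVector w)⟫_ℂ =
        ∑ w ∈ s, ∑ u ∈ t, (starRingEnd ℂ (d u) * c w) * S (basisVector w) u := by
    intro S c d
    simp only [map_sum, map_smul, inner_sum, sum_inner, inner_smul_left, inner_smul_right,
      inner_basisVector]
    refine Finset.sum_congr rfl fun w _ => ?_
    rw [Finset.mul_sum]
    exact Finset.sum_congr rfl fun u _ => by ring
  have hpz : ⟪∑ u ∈ t, d u • basisVector u, abelMean T z F (∑ w ∈ s, c w • basisVector w)⟫_ℂ =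
      p z := by
    rw [hp]
    simp only [abelMean_basisVector_apply hT hz, p]
  rw [hpz]
  have hdiff : Differentiable ℂ p := by fun_prop
  refine Complex.norm_le_of_forall_mem_frontier_norm_le (Metric.isBounded_ball (x := 0) (r := 1))
    hdiff.diffContOnCl (fun ζ hζ => ?_) (subset_closure (mem_ball_zero_iff.2 hz))
  rw [frontier_ball _ one_ne_zero, mem_sphere_zero_iff_norm] at hζ
  have hζ0 : ζ ≠ 0 := fun h => by simp [h] at hζ
  let c' : FreeSemigroupoid V → ℂ := fun w => (if w.range ∈ F then 1 else 0) * ζ⁻¹ ^ w.length * c w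
  let d' : FreeSemigroupoid V → ℂ := fun u => starRingEnd ℂ (ζ ^ u.length) * d u
  have hpζ : p ζ = ⟪∑ u ∈ t, d' u • basisVector u, T (∑ w ∈ s, c' w • basisVector w)⟫_ℂ := by
    rw [hp]
    refine Finset.sum_congr rfl fun w _ => Finset.sum_congr rfl fun u _ => ?_
    -- The truncated subtraction in the exponent does no harm: where it truncates, the matrix
    -- coefficient of `T` vanishes.
    rcases lt_or_ge u.length w.length with hlt | hle
    · simp [apply_basisVector_apply_of_length_lt hT hlt]
    · obtain ⟨n, hn⟩ := Nat.exists_eq_add_of_le hle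
      simp only [c', d', map_mul, Complex.conj_conj, hn, Nat.add_sub_cancel_left, pow_add, inv_pow]
      field_simp
  rw [hpζ]
  refine (norm_inner_le_norm _ _).trans ?_
  rw [mul_comm]
  refine mul_le_mul ((T.le_opNorm _).trans (mul_le_mul_of_nonneg_left ?_ (norm_nonneg _))) ?_
    (norm_nonneg _) (by positivity)
  · refine norm_sum_smul_basisVector_le (fun w => ?_) s
    simp only [c']
    split_ifs <;> simp [hζ]
  · refine norm_sum_smul_basisVector_le (fun w => ?_) t
    simp [d', hζ]

theorem norm_abelMean_le (hT : T ∈ rightCommutant V) {z : ℂ} (hz : ‖z‖ < 1) (F : Finset V) :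
    ‖abelMean T z F‖ ≤ ‖T‖ := by
  refine ContinuousLinearMap.opNorm_le_bound _ (norm_nonneg _) fun f => ?_
  have key : ∀ g : FockSpace V, ‖⟪g, abelMean T z F f⟫_ℂ‖ ≤ ‖T‖ * ‖f‖ * ‖g‖ := by
    intro g
    have hf := Filter.Tendsto.comp (hasSum_basisVector f)
      (Filter.tendsto_fst (f := Filter.atTop) (g := (Filter.atTop :
        Filter (Finset (FreeSemigroupoid V)))))
    have hg := Filter.Tendsto.comp (hasSum_basisVector g)
      (Filter.tendsto_snd (g := Filter.atTop) (f := (Filter.atTop :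
        Filter (Finset (FreeSemigroupoid V)))))
    have h1 := (hg.inner (𝕜 := ℂ) (((abelMean T z F).continuous.tendsto f).comp hf)).norm
    have h2 := ((hf.norm.const_mul ‖T‖).mul hg.norm)
    exact le_of_tendsto_of_tendsto' h1 h2 fun i =>
      norm_inner_abelMean_sum_le hT hz F f g i.1 i.2
  -- Testing against the image of `f` turns the bound on the form into a bound on the norm.
  have h1 := key (abelMean T z F f)
  rw [inner_self_eq_norm_sq_to_K, norm_pow, RCLike.norm_ofReal, abs_norm, sq] at h1
  rcases (norm_nonneg (abelMean T z F f)).eq_or_lt with h0 | h0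
  · rw [← h0]; positivity
  · exact le_of_mul_le_mul_right h1 h0

/-- The free semigroupoid algebra is the commutant of the right translations. -/
theorem mem_freeSemigroupoidAlgebra_iff :
    T ∈ freeSemigroupoidAlgebra V ↔ T ∈ rightCommutant V := by
  classical
  refine ⟨freeSemigroupoidAlgebra_subset_rightCommutant, fun hT => ?_⟩
  have hr : ∀ᶠ i : ℝ × Finset V in nhdsWithin 1 (Set.Iio 1) ×ˢ Filter.atTop,
      ‖(i.1 : ℂ)‖ < 1 := by
    have : ∀ᶠ r : ℝ in nhdsWithin 1 (Set.Iio 1), ‖(r : ℂ)‖ < 1 := by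
      filter_upwards [Ioo_mem_nhdsLT (show (0 : ℝ) < 1 by norm_num)] with r hr
      rw [Complex.norm_real, Real.norm_of_nonneg hr.1.le]
      exact hr.2
    exact this.prod_inl _
  refine mem_freeSemigroupoidAlgebra_of_tendsto
    (l := nhdsWithin (1 : ℝ) (Set.Iio 1) ×ˢ (Filter.atTop : Filter (Finset V)))
    (B := fun i => abelMean T i.1 i.2) (C := ‖T‖) ?_ fun w u => ?_
  · filter_upwards [hr] with i hi
    exact ⟨abelMean_mem hi _, norm_abelMean_le hT hi _⟩
  · have h1 : Filter.Tendsto (fun i : ℝ × Finset V =>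
        (i.1 : ℂ) ^ (u.length - w.length) * T (basisVector w) u)
        (nhdsWithin 1 (Set.Iio 1) ×ˢ Filter.atTop) (nhds (T (basisVector w) u)) := by
      have h2 : Continuous fun r : ℝ => (r : ℂ) ^ (u.length - w.length) * T (basisVector w) u := by
        fun_prop
      have h3 := ((h2.tendsto 1).mono_left nhdsWithin_le_nhds).comp
        (Filter.tendsto_fst (f := nhdsWithin (1 : ℝ) (Set.Iio 1))
          (g := (Filter.atTop : Filter (Finset V))))
      simpa [Function.comp_def] using h3
    refine h1.congr' ?_
    have h4 : ∀ᶠ i : ℝ × Finset V in nhdsWithin 1 (Set.Iio 1) ×ˢ Filter.atTop,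
        {w.range} ≤ i.2 := (Filter.eventually_ge_atTop {w.range}).prod_inr _
    filter_upwards [hr, h4] with i hi hi'
    rw [abelMean_basisVector_apply hT hi, if_pos (by simpa using hi'), one_mul]

end Fock

/-! ### Toeplitz factorization and isometric columns -/

/-- A defect operator of a strict contraction. -/
theorem exists_sqrt_one_sub {H : Type*} [NormedAddCommGroup H] [InnerProductSpace ℂ H]
    [CompleteSpace H] {X : H →L[ℂ] H} (hnorm : ‖X‖ < 1) :
    ∃ Q : H →L[ℂ] H, adjoint Q = Q ∧ Q * Q = 1 - adjoint X * X ∧ IsUnit (1 - adjoint X * X) := by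
  have hlt : ‖star X * X‖ < 1 := by
    rw [CStarRing.norm_star_mul_self]
    exact mul_lt_one_of_nonneg_of_lt_one_left (norm_nonneg _) hnorm hnorm.le
  have hpos : 0 ≤ 1 - star X * X :=
    sub_nonneg.2 ((CStarAlgebra.norm_le_one_iff_of_nonneg _ (star_mul_self_nonneg X)).1 hlt.le)
  exact ⟨CFC.sqrt (1 - star X * X), IsSelfAdjoint.of_nonneg (CFC.sqrt_nonneg _),
    CFC.sqrt_mul_sqrt_self _ hpos, isUnit_one_sub_of_norm_lt_one hlt⟩

section Factorization

variable {V : Type u} [Quiver.{v} V]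

theorem rightTranslation_mul_of_ne {v w : FreeSemigroupoid V} (h : w.source ≠ v.range) :
    rightTranslation v * rightTranslation w = 0 := by
  refine operator_ext fun u => ?_
  obtain ⟨a, b, p⟩ := w
  obtain ⟨c, d, q⟩ := u
  rw [mul_apply_eq_comp, zero_apply]
  by_cases hc : c = b
  · subst hc
    rw [rightTranslation_basisVector]
    exact rightTranslation_basisVector_of_ne h
  · rw [rightTranslation_basisVector_of_ne hc, map_zero]

theorem rightTranslation_apply_vertex {w : FreeSemigroupoid V} (h : 0 < w.length) (x : V)
    (f : FockSpace V) : rightTranslation w f (vertex x) = 0 := by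
  refine rightTranslation_apply_of_ne (fun v hv => ?_) f
  obtain ⟨a, b, p⟩ := w
  obtain ⟨c, q, rfl, hu⟩ := rightMul_eq_some hv
  have := congrArg FreeSemigroupoid.length hu
  simp only [FreeSemigroupoid.length, vertex, Quiver.Path.length_comp, Quiver.Path.length_nil] at this h
  omega

/-- The Toeplitz relations: the compressions of `T` by right translations are again of the form
`T R`. -/
def IsToeplitz (T : FockSpace V →L[ℂ] FockSpace V) : Prop :=
  ∀ v w : FreeSemigroupoid V, v.length ≤ w.length →
    adjoint (rightTranslation v) * T * rightTranslation w =
      T * (adjoint (rightTranslation v) * rightTranslation w)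

/-- Taking adjoints, $R_v^*$ commutes with $X^*$. For $|v|\le|w|$ the product $R_v^*R_w$ is $0$ or a
right translation, so it commutes with $X$. -/
theorem isToeplitz_one_sub {X : FockSpace V →L[ℂ] FockSpace V} (hX : X ∈ rightCommutant V) :
    IsToeplitz (1 - adjoint X * X) := by
  intro v w hl
  rw [mem_rightCommutant] at hX
  have h1 : adjoint (rightTranslation v) * adjoint X = adjoint X * adjoint (rightTranslation v) := by
    have := congrArg star (hX v)
    rw [star_mul, star_mul] at this
    exact this.symm
  have h2 : adjoint (rightTranslation v) * rightTranslation w * X =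
      X * (adjoint (rightTranslation v) * rightTranslation w) := by
    rcases adjoint_rightTranslation_mul_cases v w hl with h | ⟨a, b, c, p, q, rfl, rfl⟩
    · rw [h, zero_mul, mul_zero]
    · rw [adjoint_rightTranslation_mul, hX]
  calc adjoint (rightTranslation v) * (1 - adjoint X * X) * rightTranslation w
      = adjoint (rightTranslation v) * rightTranslation w -
        (adjoint (rightTranslation v) * adjoint X) * (X * rightTranslation w) := by noncomm_ring
    _ = adjoint (rightTranslation v) * rightTranslation w -
        adjoint X * (adjoint (rightTranslation v) * rightTranslation w * X) := by
      rw [h1, ← hX w]; noncomm_ring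
    _ = _ := by rw [h2]; noncomm_ring

theorem IsToeplitz.vertex_comm {T : FockSpace V →L[ℂ] FockSpace V} (hT : IsToeplitz T) (x : V) :
    rightTranslation (vertex x) * T = T * rightTranslation (vertex x) := by
  refine operator_ext fun w => ?_
  have h := hT (vertex x) w (Nat.zero_le _)
  rw [adjoint_rightTranslation_vertex, ← mul_assoc] at h
  have h1 := congrArg (fun S => S (basisVector (vertex w.range))) h
  simpa only [mul_apply_eq_comp, rightTranslation_vertex] using h1

/-- `R_e* T` and `T R_e*` agree on the vectors without components at the vertices. -/
theorem IsToeplitz.edge_comm {T : FockSpace V →L[ℂ] FockSpace V} (hT : IsToeplitz T)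
    {v : FreeSemigroupoid V} (hv : v.length = 1) {f : FockSpace V}
    (hf : ∀ w, w.length = 0 → f w = 0) :
    adjoint (rightTranslation v) (T f) = T (adjoint (rightTranslation v) f) := by
  rw [← sub_eq_zero]
  refine apply_eq_zero_of_components (adjoint (rightTranslation v) * T -
    T * adjoint (rightTranslation v)) f fun w hw => ?_
  have hl : v.length ≤ w.length := by
    rw [hv]
    exact Nat.one_le_iff_ne_zero.2 fun h => hw (hf w h)
  have h1 := congrArg (fun S => S (basisVector (vertex w.range))) (hT v w hl)
  simp only [mul_apply_eq_comp, rightTranslation_vertex] at h1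
  rw [sub_apply, mul_apply_eq_comp, mul_apply_eq_comp, h1, sub_self]

/-- An invertible Toeplitz operator `T = Q²` with `Q` self-adjoint factors as `T = Y* Y` with `Y` in
the commutant of the right translations. -/
theorem IsToeplitz.exists_factor {T Q : FockSpace V →L[ℂ] FockSpace V} (hT : IsToeplitz T)
    (hunit : IsUnit T) (hQ : adjoint Q = Q) (hQT : Q * Q = T) :
    ∃ Y ∈ rightCommutant V, adjoint Y * Y = T := by
  obtain ⟨S, hTS, hST⟩ := isUnit_iff_exists.1 hunit
  have hTS' : ∀ f, T (S f) = f := fun f => congrArg (fun A => A f) hTS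
  have hST' : ∀ f, S (T f) = f := fun f => congrArg (fun A => A f) hST
  have hQQ : ∀ f, Q (Q f) = T f := fun f => congrArg (fun A => A f) hQT
  have hQin : ∀ f g, ⟪Q f, g⟫_ℂ = ⟪f, Q g⟫_ℂ := fun f g => by
    rw [← ContinuousLinearMap.adjoint_inner_right, hQ]
  have hTin : ∀ f g, ⟪T f, g⟫_ℂ = ⟪f, T g⟫_ℂ := fun f g => by
    rw [← hQQ, ← hQQ, hQin, hQin]
  have hξ : ∀ x : V, Q (S (basisVector (vertex x))) ≠ 0 := fun x h => by
    have h1 := congrArg Q h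
    rw [hQQ, hTS', map_zero] at h1
    have h2 := norm_basisVector (vertex x)
    rw [h1, norm_zero] at h2
    exact zero_ne_one h2
  let c : V → ℂ := fun x => ((‖Q (S (basisVector (vertex x)))‖⁻¹ : ℝ) : ℂ)
  have hc : ∀ x, c x ≠ 0 := fun x => by simpa [c] using hξ x
  -- These are the wandering vectors for the inner product $\langle f,Tg\rangle$: as $T\eta_x$ is a
  -- multiple of $\xi_x$, they are orthogonal in it to all vectors without vertex components. The
  -- factor `c x` normalises them.
  let η : V → FockSpace V := fun x => c x • S (basisVector (vertex x))
  have hTη : ∀ x, T (η x) = c x • basisVector (vertex x) := fun x => by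
    simp only [η, map_smul, hTS']
  have hQη : ∀ x, ‖Q (η x)‖ = 1 := fun x => by
    simp only [η, map_smul, norm_smul, c]
    rw [Complex.norm_real, norm_inv, norm_norm]
    exact inv_mul_cancel₀ (norm_ne_zero_iff.2 (hξ x))
  have hRη : ∀ x, rightTranslation (vertex x) (η x) = η x := fun x => by
    have h1 := congrArg (fun A => A (η x)) (hT.vertex_comm x)
    simp only [mul_apply_eq_comp, hTη, map_smul] at h1
    rw [show rightTranslation (vertex x) (basisVector (vertex x)) = basisVector (vertex x) from
      rightTranslation_vertex (vertex x)] at h1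
    rw [← hST' (rightTranslation (vertex x) (η x)), ← h1, ← hTη, hST']
  let b : FreeSemigroupoid V → FockSpace V := fun w => Q (rightTranslation w (η w.range))
  have hinner : ∀ v w f, v.length ≤ w.length → ⟪rightTranslation v (η v.range),
      T (rightTranslation w f)⟫_ℂ =
      ⟪η v.range, T ((adjoint (rightTranslation v) * rightTranslation w) f)⟫_ℂ := by
    intro v w f hl
    rw [← ContinuousLinearMap.adjoint_inner_right]
    exact congrArg (fun A => ⟪η v.range, A f⟫_ℂ) (hT v w hl)
  have hvanish : ∀ v w f, v.length ≤ w.length → v ≠ w → ⟪rightTranslation v (η v.range),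
      T (rightTranslation w f)⟫_ℂ = 0 := by
    intro v w f hl hne
    rw [hinner v w f hl]
    rcases adjoint_rightTranslation_mul_cases v w hl with h | ⟨a, x, y, p, q, rfl, rfl⟩
    · rw [h, zero_apply, map_zero, inner_zero_right]
    · rw [adjoint_rightTranslation_mul, ← hTin, hTη, inner_smul_left, inner_basisVector,
        rightTranslation_apply_vertex, mul_zero]
      refine Nat.pos_of_ne_zero fun h0 => hne ?_
      change q.length = 0 at h0
      obtain rfl := Quiver.Path.eq_of_length_zero q h0
      obtain rfl := Quiver.Path.eq_nil_of_length_zero q h0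
      rfl
  have hb : ∀ v w, ⟪b v, b w⟫_ℂ =
      ⟪rightTranslation v (η v.range), T (rightTranslation w (η w.range))⟫_ℂ := fun v w => by
    simp only [b]
    rw [hQin, hQQ]
  have hortho : Orthonormal ℂ b := by
    classical
    refine ⟨fun w => ?_, fun v w hne => ?_⟩
    · have h1 : ⟪b w, b w⟫_ℂ = 1 := by
        rw [hb, hinner w w _ le_rfl, adjoint_rightTranslation_mul_self, hRη, ← hQQ, ← hQin,
          inner_self_eq_norm_sq_to_K, hQη]
        norm_num
      rw [inner_self_eq_norm_sq_to_K] at h1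
      have h2 : ‖b w‖ ^ 2 = 1 := Complex.ofReal_injective (by simpa using h1)
      exact (pow_eq_one_iff_of_nonneg (norm_nonneg _) two_ne_zero).1 h2
    · rcases le_total v.length w.length with hl | hl
      · rw [hb]
        exact hvanish v w _ hl hne
      · rw [← inner_conj_symm, hb, hvanish w v _ hl hne.symm, map_zero]
  -- Completeness of the family `b`, by induction on path length. Pairing with $T\eta_x$ kills the
  -- vertex components of $f$. By `IsToeplitz.edge_comm`, $R_e^*f$ then satisfies the same
  -- orthogonality relations, and its coefficients are those of $f$ at the paths that begin with
  -- $e$.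
  have hzero : ∀ (n : ℕ) (f : FockSpace V),
      (∀ w, ⟪T (rightTranslation w (η w.range)), f⟫_ℂ = 0) → ∀ u, u.length = n → f u = 0 := by
    have h0 : ∀ (f : FockSpace V),
        (∀ w, ⟪T (rightTranslation w (η w.range)), f⟫_ℂ = 0) → ∀ u, u.length = 0 → f u = 0 := by
      intro f hf u hu
      obtain ⟨x, y, p⟩ := u
      obtain rfl := Quiver.Path.eq_of_length_zero p hu
      obtain rfl := Quiver.Path.eq_nil_of_length_zero p hu
      have h1 := hf (vertex x)
      rw [show (vertex x).range = x from rfl, hRη, hTη, inner_smul_left, inner_basisVector] at h1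
      exact (mul_eq_zero.1 h1).resolve_left (by simpa using hc x)
    intro n
    induction n with
    | zero => exact h0
    | succ n ih =>
      intro f hf u hu
      obtain ⟨x, y, p⟩ := u
      obtain ⟨z, e, q, hpq, hl⟩ := (Quiver.Path.length_ne_zero_iff_eq_comp p).1
        (by change p.length = n + 1 at hu; omega)
      subst hpq
      rw [← adjoint_rightTranslation_apply]
      refine ih _ (fun w => ?_) _ (by
        change (e.toPath.comp q).length = n + 1 at hu
        change q.length = n
        omega)
      rw [hTin, ← hT.edge_comm rfl (h0 f hf), ContinuousLinearMap.adjoint_inner_right, ← hTin]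
      obtain ⟨z', y', r⟩ := w
      change ⟪T ((rightTranslation ⟨x, z, e.toPath⟩ * rightTranslation ⟨z', y', r⟩) (η y')), f⟫_ℂ = 0
      by_cases hz : z' = z
      · subst hz
        rw [rightTranslation_mul]
        exact hf ⟨x, y', _⟩
      · rw [rightTranslation_mul_of_ne hz, zero_apply, map_zero, inner_zero_left]
  have hbot : (Submodule.span ℂ (Set.range b))ᗮ = ⊥ := by
    rw [Submodule.eq_bot_iff]
    intro f hf
    have h1 : ∀ w, ⟪b w, f⟫_ℂ = 0 := fun w =>
      (Submodule.mem_orthogonal _ _).1 hf _ (Submodule.subset_span ⟨w, rfl⟩)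
    have h2 : Q (Q (S f)) = f := by rw [hQQ, hTS']
    have h3 : Q (S f) = 0 := by
      ext u
      refine hzero _ _ (fun w => ?_) u rfl
      rw [← hQQ, hQin, h2]
      exact h1 w
    rw [← h2, h3, map_zero]
  let B : HilbertBasis (FreeSemigroupoid V) ℂ (FockSpace V) :=
    HilbertBasis.mkOfOrthogonalEqBot hortho hbot
  -- `Y` is `Q` followed by the unitary that takes `b w` to $\xi_w$. So $Y^*Y=Q^2$, and the unitary
  -- is what brings `Y` into the commutant.
  let Y : FockSpace V →L[ℂ] FockSpace V := (B.repr.toContinuousLinearEquiv.toContinuousLinearMap).comp Q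
  have hY : ∀ f w, Y f w = ⟪rightTranslation w (η w.range), T f⟫_ℂ := by
    intro f w
    change B.repr (Q f) w = _
    rw [HilbertBasis.repr_apply_apply, ← hQQ, ← hQin (rightTranslation w (η w.range))]
    exact congrArg (fun g => ⟪g, Q f⟫_ℂ)
      (congrFun (HilbertBasis.coe_mkOfOrthogonalEqBot hortho hbot) w)
  refine ⟨Y, ?_, ?_⟩
  · rw [mem_rightCommutant]
    intro w
    ext f v
    rw [mul_apply_eq_comp, mul_apply_eq_comp, hY]
    by_cases hv : ∃ t, rightMul w t = some v
    · obtain ⟨t, ht⟩ := hv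
      obtain ⟨x, y, p⟩ := w
      obtain ⟨z, q, rfl, rfl⟩ := rightMul_eq_some ht
      have h1 := congrArg (fun A => A (η z)) (hT ⟨x, y, p⟩ ⟨x, z, p.comp q⟩
        (by simp [FreeSemigroupoid.length]))
      rw [adjoint_rightTranslation_mul] at h1
      simp only [mul_apply_eq_comp] at h1
      rw [rightTranslation_apply, hY, ← hTin, ← hTin, ← ContinuousLinearMap.adjoint_inner_left, h1]
    · push Not at hv
      rw [rightTranslation_apply_of_ne hv]
      rcases le_total v.length w.length with hl | hl
      · rw [hvanish v w f hl]
        rintro rfl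
        exact hv (vertex v.range) (rightMul_mk v.path Quiver.Path.nil)
      · have h1 := congrArg (fun A => A (η v.range)) (hT w v hl)
        rcases adjoint_rightTranslation_mul_cases w v hl with h | ⟨a, x, y, p, q, rfl, rfl⟩
        · rw [h] at h1
          simp only [mul_apply_eq_comp, zero_apply, map_zero] at h1
          rw [← hTin, ← ContinuousLinearMap.adjoint_inner_left, h1, inner_zero_left]
        · exact (hv ⟨x, y, q⟩ (rightMul_mk p q)).elim
  · ext1 f
    refine ext_inner_left ℂ fun g => ?_
    rw [mul_apply_eq_comp, ContinuousLinearMap.adjoint_inner_right, ← hQQ, ← hQin]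
    exact B.repr.inner_map_map _ _

/-- A strict contraction `X` in the commutant of the right translations can be completed to an
isometric column within the commutant. -/
theorem exists_isometric_column {X : FockSpace V →L[ℂ] FockSpace V} (hX : X ∈ rightCommutant V)
    (hnorm : ‖X‖ < 1) : ∃ Y ∈ rightCommutant V, star X * X + star Y * Y = 1 := by
  obtain ⟨Q, hQ, hQT, hunit⟩ := exists_sqrt_one_sub hnorm
  obtain ⟨Y, hY, hYT⟩ := (isToeplitz_one_sub hX).exists_factor hunit hQ hQT
  refine ⟨Y, hY, ?_⟩
  change adjoint X * X + adjoint Y * Y = 1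
  rw [hYT]
  abel

end Factorization

/-! ### Averages of isometries in an algebra of operators -/

section Averages

variable {H : Type*} [NormedAddCommGroup H] [InnerProductSpace ℂ H] [CompleteSpace H]

/-- `A` is the sum of `n` isometries in the algebra `𝒜`. -/
def IsSumOfIsometries (𝒜 : Subalgebra ℂ (H →L[ℂ] H)) (n : ℕ) (A : H →L[ℂ] H) : Prop :=
  ∃ U : Fin n → H →L[ℂ] H, (∀ i, U i ∈ 𝒜 ∧ star (U i) * U i = 1) ∧ A = ∑ i, U i

variable {𝒜 : Subalgebra ℂ (H →L[ℂ] H)}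

theorem IsSumOfIsometries.add {m n : ℕ} {A B : H →L[ℂ] H} (hA : IsSumOfIsometries 𝒜 m A)
    (hB : IsSumOfIsometries 𝒜 n B) : IsSumOfIsometries 𝒜 (m + n) (A + B) := by
  obtain ⟨U, hU, rfl⟩ := hA
  obtain ⟨W, hW, rfl⟩ := hB
  refine ⟨Fin.append U W, fun i => ?_, by simp [Fin.sum_univ_add]⟩
  induction i using Fin.addCases with
  | left i => simpa using hU i
  | right i => simpa using hW i

theorem IsSumOfIsometries.sum {n : ℕ} {A : ℕ → H →L[ℂ] H}
    (hA : ∀ j, IsSumOfIsometries 𝒜 n (A j)) (m : ℕ) :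
    IsSumOfIsometries 𝒜 (m * n) (∑ j ∈ Finset.range m, A j) := by
  induction m with
  | zero =>
    rw [zero_mul, Finset.range_zero, Finset.sum_empty]
    exact ⟨Fin.elim0, fun i => i.elim0, by simp⟩
  | succ m ih =>
    rw [Finset.sum_range_succ, Nat.succ_mul]
    exact ih.add (hA m)

/-- Two isometries with orthogonal ranges. -/
structure IsOrthogonalPair (P Q : H →L[ℂ] H) : Prop where
  left : star P * P = 1
  right : star Q * Q = 1
  orthogonal : star P * Q = 0

theorem IsOrthogonalPair.orthogonal' {P Q : H →L[ℂ] H} (h : IsOrthogonalPair P Q) :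
    star Q * P = 0 := by
  have := congrArg star h.orthogonal
  rwa [star_mul, star_star, star_zero] at this

/-- The two isometries are $PX\pm QY$; the cross terms vanish because the ranges of $P$ and $Q$ are
orthogonal. -/
theorem IsOrthogonalPair.isSumOfIsometries {P Q X Y : H →L[ℂ] H} (h : IsOrthogonalPair P Q)
    (hP : P ∈ 𝒜) (hQ : Q ∈ 𝒜) (hX : X ∈ 𝒜) (hY : Y ∈ 𝒜) (hXY : star X * X + star Y * Y = 1) :
    IsSumOfIsometries 𝒜 2 ((2 : ℂ) • (P * X)) := by
  refine ⟨![P * X + Q * Y, P * X - Q * Y], fun i => ?_, ?_⟩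
  · have h1 : star (P * X) * (P * X) = star X * X := by
      rw [star_mul, mul_assoc, ← mul_assoc (star P), h.left, one_mul]
    have h2 : star (Q * Y) * (Q * Y) = star Y * Y := by
      rw [star_mul, mul_assoc, ← mul_assoc (star Q), h.right, one_mul]
    have h3 : star (P * X) * (Q * Y) = 0 := by
      rw [star_mul, mul_assoc, ← mul_assoc (star P), h.orthogonal, zero_mul, mul_zero]
    have h4 : star (Q * Y) * (P * X) = 0 := by
      rw [star_mul, mul_assoc, ← mul_assoc (star Q), h.orthogonal', zero_mul, mul_zero]
    fin_cases i
    · refine ⟨add_mem (mul_mem hP hX) (mul_mem hQ hY), ?_⟩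
      change star (P * X + Q * Y) * (P * X + Q * Y) = 1
      rw [star_add, add_mul, mul_add, mul_add, h1, h2, h3, h4, ← hXY]
      abel
    · refine ⟨sub_mem (mul_mem hP hX) (mul_mem hQ hY), ?_⟩
      change star (P * X - Q * Y) * (P * X - Q * Y) = 1
      rw [star_sub, sub_mul, mul_sub, mul_sub, h1, h2, h3, h4, ← hXY]
      abel
  · rw [Fin.sum_univ_two]
    change _ = P * X + Q * Y + (P * X - Q * Y)
    module

theorem norm_le_one_of_star_mul_self {K : H →L[ℂ] H} (hK : star K * K = 1) : ‖K‖ ≤ 1 := by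
  have h1 := CStarRing.norm_star_mul_self (x := K)
  rw [hK] at h1
  have h2 : ‖(1 : H →L[ℂ] H)‖ ≤ 1 := ContinuousLinearMap.norm_id_le
  nlinarith [norm_nonneg K]

/-- The Möbius transform `(t - K)(1 - tK)⁻¹` of an isometry `K` is an isometry, and its range is
orthogonal to that of `(1 - tK)⁻¹ Q` if the range of `Q` is orthogonal to that of `K`. -/
theorem IsOrthogonalPair.moebius {K Q G : H →L[ℂ] H} (h : IsOrthogonalPair K Q) {t : ℝ}
    (ht : t ^ 2 < 1) (hG : (1 - (t : ℂ) • K) * G = 1) :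
    IsOrthogonalPair (((t : ℂ) • 1 - K) * G) (((√(1 - t ^ 2) : ℝ) : ℂ) • (G * Q)) := by
  have hconj : star (t : ℂ) = t := Complex.conj_ofReal t
  have hG' : G = 1 + (t : ℂ) • (K * G) := by
    rw [sub_mul, one_mul, smul_mul_assoc, sub_eq_iff_eq_add] at hG
    exact hG
  -- From $K^*K=1$ one has $t-K^*=-K^*(1-tK)$.
  have hKG : ((t : ℂ) • 1 - star K) * G = - star K := by
    rw [sub_mul, smul_mul_assoc, one_mul]
    nth_rewrite 2 [hG']
    rw [mul_add, mul_one, mul_smul_comm, ← mul_assoc, h.left, one_mul]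
    abel
  refine ⟨?_, ?_, ?_⟩
  · have h1 : star ((t : ℂ) • 1 - K) * ((t : ℂ) • 1 - K) =
        star (1 - (t : ℂ) • K) * (1 - (t : ℂ) • K) := by
      simp only [star_sub, star_smul, star_one, hconj, mul_sub, sub_mul, smul_mul_assoc,
        mul_smul_comm, one_mul, mul_one, h.left]
      module
    rw [star_mul, mul_assoc, ← mul_assoc _ _ G, h1, mul_assoc, hG, mul_one, ← star_mul, hG,
      star_one]
  · have h2 : star G * G = 1 + (t : ℂ) • (K * G) + (t : ℂ) • (star G * star K) +
        ((t : ℂ) ^ 2) • (star G * G) := by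
      nth_rewrite 1 2 [hG']
      simp only [star_add, star_smul, star_one, star_mul, hconj, mul_add, add_mul, smul_mul_assoc,
        mul_smul_comm, one_mul, mul_one]
      rw [mul_assoc (star G) (star K), ← mul_assoc (star K), h.left, one_mul]
      module
    -- Compressing to the range of `Q` removes both cross terms, so $Q^*G^*GQ=(1-t^2)^{-1}$. This
    -- explains the factor $\sqrt{1-t^2}$.
    have h3 : star Q * (star G * G) * Q = 1 + ((t : ℂ) ^ 2) • (star Q * (star G * G) * Q) := by
      nth_rewrite 1 [h2]
      simp only [mul_add, add_mul, mul_smul_comm, smul_mul_assoc, mul_one, h.right]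
      rw [← mul_assoc (star Q) K, h.orthogonal', mul_assoc (star Q), mul_assoc (star G),
        h.orthogonal]
      simp
    have h4 : (1 - (t : ℂ) ^ 2) • (star Q * (star G * G) * Q) = 1 := by
      rw [sub_smul, one_smul]
      nth_rewrite 1 [h3]
      abel
    have h5 : ((√(1 - t ^ 2) : ℝ) : ℂ) * ((√(1 - t ^ 2) : ℝ) : ℂ) = 1 - (t : ℂ) ^ 2 := by
      rw [← Complex.ofReal_mul, Real.mul_self_sqrt (by linarith)]
      push_cast
      rfl
    rw [star_smul, smul_mul_assoc, mul_smul_comm, smul_smul, star_mul]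
    rw [show star ((√(1 - t ^ 2) : ℝ) : ℂ) = ((√(1 - t ^ 2) : ℝ) : ℂ) from Complex.conj_ofReal _,
      h5, ← h4]
    simp only [mul_assoc]
  · rw [star_mul, mul_smul_comm, mul_assoc, ← mul_assoc _ G Q, star_sub, star_smul, star_one, hconj,
      hKG, neg_mul, h.orthogonal]
    simp

theorem sum_pow_mul_of_isPrimitiveRoot {m : ℕ} {ω : ℂ} (hω : IsPrimitiveRoot ω m) {i : ℕ}
    (hi : i ≠ 0) (him : i < m) : ∑ j ∈ Finset.range m, (ω ^ j) ^ i = 0 := by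
  have h1 : ω ^ i ≠ 1 := hω.pow_ne_one_of_pos_of_lt hi him
  have h2 : (∑ j ∈ Finset.range m, (ω ^ i) ^ j) * (ω ^ i - 1) = 0 := by
    rw [geom_sum_mul, ← pow_mul, mul_comm, pow_mul, hω.pow_eq_one, one_pow, sub_self]
  have h3 := (mul_eq_zero.1 h2).resolve_right (sub_ne_zero.2 h1)
  rw [← h3]
  exact Finset.sum_congr rfl fun j _ => by rw [← pow_mul, ← pow_mul, mul_comm]

/-- Averaging the resolvents of `ω ^ j S` over the roots of unity. -/
theorem sum_resolvent {m : ℕ} (hm : 0 < m) {ω : ℂ} (hω : IsPrimitiveRoot ω m) (t : ℂ)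
    {R : Type*} [Ring R] [Algebra ℂ R] {S M : R} {G : ℕ → R} (hM : (1 - t ^ m • S ^ m) * M = 1)
    (hG : ∀ j, G j * (1 - t • ω ^ j • S) = 1) :
    ∑ j ∈ Finset.range m, G j = (m : ℂ) • M := by
  have h1 : ∀ j, G j * (1 - t ^ m • S ^ m) =
      ∑ i ∈ Finset.range m, (ω ^ j) ^ i • t ^ i • S ^ i := by
    intro j
    have h2 := mul_neg_geom_sum (t • ω ^ j • S) m
    have h3 : (t • ω ^ j • S) ^ m = t ^ m • S ^ m := by
      rw [smul_pow, smul_pow, ← pow_mul, mul_comm, pow_mul, hω.pow_eq_one, one_pow, one_smul]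
    rw [← h3, ← h2, ← mul_assoc, hG, one_mul]
    refine Finset.sum_congr rfl fun i _ => ?_
    rw [smul_pow, smul_pow, smul_comm]
  have h4 : (∑ j ∈ Finset.range m, G j) * (1 - t ^ m • S ^ m) = (m : ℂ) • 1 := by
    rw [Finset.sum_mul, Finset.sum_congr rfl fun j _ => h1 j, Finset.sum_comm,
      Finset.sum_eq_single 0]
    · simp [Nat.cast_smul_eq_nsmul]
    · intro i hi hi0
      rw [← Finset.sum_smul, sum_pow_mul_of_isPrimitiveRoot hω hi0 (Finset.mem_range.1 hi),
        zero_smul]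
    · intro h
      exact (h (Finset.mem_range.2 hm)).elim
  rw [← mul_one (∑ j ∈ Finset.range m, G j), ← hM, ← mul_assoc, h4, smul_mul_assoc, one_mul]

/-- Bernoulli's inequality $(1+1/n)^n\ge2$, inverted. -/
theorem pow_le_half (n : ℕ) (hn : 1 ≤ n) : ((n : ℝ) / (n + 1)) ^ n ≤ 1 / 2 := by
  have hn0 : (0 : ℝ) < n := by exact_mod_cast hn
  have h1 := one_add_mul_le_pow (a := 1 / (n : ℝ)) (by
    have : (0 : ℝ) ≤ 1 / n := by positivity
    linarith) n
  rw [mul_one_div_cancel hn0.ne'] at h1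
  have h2 : (n : ℝ) / (n + 1) = (1 + 1 / (n : ℝ))⁻¹ := by field_simp
  rw [h2, inv_pow, show (1 : ℝ) / 2 = 2⁻¹ by norm_num]
  exact inv_anti₀ (by norm_num) (by linarith)

/-- Sums of isometries that approximate the multiples of the identity: the Möbius transforms of the
isometries `ω ^ j S`, with `ω` a root of unity, add up to `n - 2SZ` for a strict contraction `Z`. -/
theorem exists_sum_moebius {S Q : H →L[ℂ] H} (hS : S ∈ 𝒜) (hQ : Q ∈ 𝒜)
    (hSQ : IsOrthogonalPair S Q)
    (hinv : ∀ X ∈ 𝒜, ∀ G, X * G = 1 → G * X = 1 → G ∈ 𝒜) (n : ℕ) (hn : 1 ≤ n) :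
    ∃ (P R : ℕ → H →L[ℂ] H) (Z : H →L[ℂ] H), (∀ j, P j ∈ 𝒜 ∧ R j ∈ 𝒜 ∧ IsOrthogonalPair (P j) (R j)) ∧
      Z ∈ 𝒜 ∧ ‖Z‖ < 1 ∧ ∑ j ∈ Finset.range (n + 1), P j + (2 : ℂ) • (S * Z) = (n : ℂ) • 1 := by
  have hn0 : (0 : ℝ) < n := by exact_mod_cast hn
  -- With $m=n+1$ roots of unity, this is the value for which $mt=n$ and $m(1-t)=1$: the identity
  -- gets the coefficient $n$ and the remainder the small factor $(1+t)t^n$.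
  set t : ℝ := n / (n + 1) with ht
  have ht0 : 0 < t := by positivity
  have ht1 : t < 1 := (div_lt_one (by positivity)).2 (by linarith)
  have htn : t ^ n ≤ 1 / 2 := pow_le_half n hn
  have ht2 : t ^ 2 < 1 := pow_lt_one₀ ht0.le ht1 two_ne_zero
  have hnt : (t : ℂ) * (n + 1) = n := by
    have : t * (n + 1) = n := div_mul_cancel₀ _ (by positivity)
    exact_mod_cast this
  have hSn : ‖S‖ ≤ 1 := norm_le_one_of_star_mul_self hSQ.left
  have hres : ∀ X : H →L[ℂ] H, X ∈ 𝒜 → ‖X‖ < 1 → ∃ G ∈ 𝒜, (1 - X) * G = 1 ∧ G * (1 - X) = 1 := by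
    intro X hX hX1
    obtain ⟨G, h1, h2⟩ := isUnit_iff_exists.1 (isUnit_one_sub_of_norm_lt_one hX1)
    exact ⟨G, hinv _ (sub_mem (one_mem _) hX) _ h1 h2, h1, h2⟩
  obtain ⟨ω, hω⟩ : ∃ ω : ℂ, IsPrimitiveRoot ω (n + 1) :=
    ⟨_, Complex.isPrimitiveRoot_exp (n + 1) n.succ_ne_zero⟩
  have hω1 : ‖ω‖ = 1 := Complex.norm_eq_one_of_pow_eq_one hω.pow_eq_one n.succ_ne_zero
  have hωj : ∀ j, star (ω ^ j) * ω ^ j = 1 := fun j => by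
    rw [Complex.star_def, Complex.conj_mul', norm_pow, hω1]
    simp
  have hK : ∀ j, IsOrthogonalPair (ω ^ j • S) Q := fun j =>
    ⟨by rw [star_smul, smul_mul_assoc, mul_smul_comm, smul_smul, hωj, hSQ.left, one_smul],
      hSQ.right, by rw [star_smul, smul_mul_assoc, hSQ.orthogonal, smul_zero]⟩
  have hKmem : ∀ j, ω ^ j • S ∈ 𝒜 := fun j => 𝒜.smul_mem hS _
  have hKn : ∀ j, ‖(t : ℂ) • ω ^ j • S‖ < 1 := fun j => by
    rw [norm_smul, Complex.norm_real, Real.norm_of_nonneg ht0.le]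
    have := norm_le_one_of_star_mul_self (hK j).left
    nlinarith
  choose G hGmem hG hG' using fun j => hres _ (𝒜.smul_mem (hKmem j) (t : ℂ)) (hKn j)
  have htm : t ^ (n + 1) ≤ t / 2 := by rw [pow_succ]; nlinarith
  have hSm : ‖(t : ℂ) ^ (n + 1) • S ^ (n + 1)‖ ≤ t ^ (n + 1) := by
    rw [norm_smul, norm_pow, Complex.norm_real, Real.norm_of_nonneg ht0.le]
    refine mul_le_of_le_one_right (by positivity) ((norm_pow_le' _ n.succ_pos).trans ?_)
    exact pow_le_one₀ (norm_nonneg _) hSn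
  obtain ⟨M, hMmem, hM, -⟩ := hres _ (𝒜.smul_mem (pow_mem hS (n + 1)) ((t : ℂ) ^ (n + 1)))
    (hSm.trans_lt (by linarith))
  have hM1 : M = 1 + ((t : ℂ) ^ (n + 1) • S ^ (n + 1)) * M := by
    rw [sub_mul, one_mul, sub_eq_iff_eq_add] at hM
    exact hM
  have hMn : ‖M‖ * (1 - t / 2) ≤ 1 := by
    have h1 : ‖M‖ ≤ 1 + t / 2 * ‖M‖ := by
      nth_rewrite 1 [hM1]
      refine (norm_add_le _ _).trans (add_le_add ContinuousLinearMap.norm_id_le ?_)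
      refine (norm_mul_le _ _).trans ?_
      gcongr
      exact hSm.trans htm
    linarith
  have hsum : ∑ j ∈ Finset.range (n + 1), G j = ((n + 1 : ℕ) : ℂ) • M := sum_resolvent n.succ_pos hω (t : ℂ) hM hG'
  refine ⟨fun j => ((t : ℂ) • 1 - ω ^ j • S) * G j,
    fun j => ((√(1 - t ^ 2) : ℝ) : ℂ) • (G j * Q),
    ((1 + t) * t ^ n / 2 : ℂ) • (S ^ n * M), fun j => ⟨?_, ?_, ?_⟩, ?_, ?_, ?_⟩
  · exact mul_mem (sub_mem (𝒜.smul_mem (one_mem _) _) (hKmem j)) (hGmem j)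
  · exact 𝒜.smul_mem (mul_mem (hGmem j) hQ) _
  · exact (hK j).moebius ht2 (hG j)
  · exact 𝒜.smul_mem (mul_mem (pow_mem hS n) hMmem) _
  · have h1 : ‖((1 + t) * t ^ n / 2 : ℂ)‖ = (1 + t) * t ^ n / 2 := by
      have : ((1 + t) * t ^ n / 2 : ℂ) = (((1 + t) * t ^ n / 2 : ℝ) : ℂ) := by push_cast; rfl
      rw [this, Complex.norm_real, Real.norm_of_nonneg (by positivity)]
    have h2 : ‖S ^ n * M‖ ≤ ‖M‖ := by
      refine (norm_mul_le _ _).trans (mul_le_of_le_one_left (norm_nonneg _) ?_)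
      exact (norm_pow_le' _ hn).trans (pow_le_one₀ (norm_nonneg _) hSn)
    rw [norm_smul, h1]
    have h3 : (1 + t) * t ^ n / 2 ≤ (1 + t) / 4 := by nlinarith
    have h4 : (1 + t) * t ^ n / 2 * ‖S ^ n * M‖ ≤ (1 + t) / 4 * ‖M‖ := by gcongr
    -- As $\|M\|\le(1-t/2)^{-1}$, the bound is $(1+t)/(4-2t)$, which is less than $1$ because $t<1$.
    refine h4.trans_lt ?_
    nlinarith [norm_nonneg M]
  -- Partial fractions: $(t-K)(1-tK)^{-1}=t^{-1}-(t^{-1}-t)(1-tK)^{-1}$. Only resolvents remain to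
  -- be summed, and $M=1+t^{n+1}S^{n+1}M$ splits off the multiple of the identity.
  · have h1 : ∀ j, ((t : ℂ) • 1 - ω ^ j • S) * G j =
        (t : ℂ)⁻¹ • 1 - ((t : ℂ)⁻¹ - t) • G j := by
      intro j
      have htc : (t : ℂ) ≠ 0 := by exact_mod_cast ht0.ne'
      have h2 : (ω ^ j • S) * G j = (t : ℂ)⁻¹ • (G j - 1) := by
        have h3 := hG j
        rw [sub_mul, one_mul, smul_mul_assoc, sub_eq_iff_eq_add, ← sub_eq_iff_eq_add'] at h3
        rw [h3, smul_smul, inv_mul_cancel₀ htc, one_smul]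
      rw [sub_mul, h2, smul_mul_assoc, one_mul]
      module
    rw [Finset.sum_congr rfl fun j _ => h1 j, Finset.sum_sub_distrib, Finset.sum_const,
      Finset.card_range, ← Finset.smul_sum, hsum]
    nth_rewrite 1 [hM1]
    have htc : (t : ℂ) ≠ 0 := by exact_mod_cast ht0.ne'
    rw [mul_smul_comm, ← mul_assoc, ← pow_succ',
      smul_mul_assoc, ← Nat.cast_smul_eq_nsmul ℂ]
    push_cast
    have e1 : ((t : ℂ)⁻¹ - t) * (n + 1) * t ^ (n + 1) = (1 + t) * t ^ n := by
      have h5 : (1 - (t : ℂ)) * (n + 1) = 1 := by linear_combination - hnt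
      field_simp
      linear_combination (1 + (t : ℂ)) * t ^ (n + 1) * h5
    have e2 : ((n : ℂ) + 1) * (t : ℂ)⁻¹ - ((t : ℂ)⁻¹ - t) * (n + 1) = n := by
      linear_combination hnt
    calc _ = (((n : ℂ) + 1) * (t : ℂ)⁻¹ - ((t : ℂ)⁻¹ - t) * (n + 1)) • (1 : H →L[ℂ] H) +
        ((1 + t) * t ^ n - ((t : ℂ)⁻¹ - t) * (n + 1) * t ^ (n + 1)) • (S ^ (n + 1) * M) := by module
      _ = _ := by rw [e1, e2, sub_self, zero_smul, add_zero]

/-- An algebra of operators with the completion property for strict contractions that contains two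
isometries with orthogonal ranges: its elements of norm less than `1 - 1 / k` are averages of `6k`
isometries. -/
theorem isSumOfIsometries_of_norm_lt {S Q : H →L[ℂ] H} (hS : S ∈ 𝒜) (hQ : Q ∈ 𝒜)
    (hSQ : IsOrthogonalPair S Q)
    (hinv : ∀ X ∈ 𝒜, ∀ G, X * G = 1 → G * X = 1 → G ∈ 𝒜)
    (hcol : ∀ X ∈ 𝒜, ‖X‖ < 1 → ∃ Y ∈ 𝒜, star X * X + star Y * Y = 1)
    {A : H →L[ℂ] H} (hA : A ∈ 𝒜) {k : ℕ} (hk : 1 ≤ k) (hnorm : ‖A‖ < 1 - 1 / (k : ℝ)) :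
    IsSumOfIsometries 𝒜 (6 * k) (((6 * k : ℕ) : ℂ) • A) := by
  obtain ⟨n, rfl⟩ := Nat.exists_eq_add_of_le' hk
  have hn : 1 ≤ n := by
    refine Nat.one_le_iff_ne_zero.2 fun h => ?_
    subst h
    norm_num at hnorm
    exact (norm_nonneg A).not_gt hnorm
  have hn0 : (0 : ℝ) < n := by exact_mod_cast hn
  have hnc : (n : ℂ) ≠ 0 := by exact_mod_cast hn0.ne'
  -- With $N$ in place of $3n$, the $2(N+1)+4$ isometries add up to $2NB$, and their average is
  -- $\frac N{N+3}B$. This equals $\frac n{n+1}B=A$ exactly for $N=3n$.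
  obtain ⟨P, R, Z, hPR, hZ, hZ1, hsum⟩ :=
    exists_sum_moebius hS hQ hSQ hinv (3 * n) (by omega)
  set B : H →L[ℂ] H := (((n : ℂ) + 1) / n) • A with hB
  have hBmem : B ∈ 𝒜 := 𝒜.smul_mem hA _
  have hB1 : ‖B‖ < 1 := by
    have h1 : (((n : ℂ) + 1) / n) = (((n + 1) / n : ℝ) : ℂ) := by push_cast; rfl
    rw [hB, h1, norm_smul, Complex.norm_real, Real.norm_of_nonneg (by positivity), div_mul_eq_mul_div,
      div_lt_one hn0]
    have h2 : 1 - 1 / ((n + 1 : ℕ) : ℝ) = n / (n + 1) := by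
      push_cast
      field_simp
      ring
    rw [h2, lt_div_iff₀ (by positivity)] at hnorm
    linarith
  have pair : ∀ {P R X : H →L[ℂ] H}, IsOrthogonalPair P R → P ∈ 𝒜 → R ∈ 𝒜 → X ∈ 𝒜 → ‖X‖ < 1 →
      IsSumOfIsometries 𝒜 2 ((2 : ℂ) • (P * X)) := by
    intro P R X h hP hR hX hX1
    obtain ⟨Y, hY, hXY⟩ := hcol X hX hX1
    exact h.isSumOfIsometries hP hR hX hY hXY
  have h1 := IsSumOfIsometries.sum (fun j => pair (hPR j).2.2 (hPR j).1 (hPR j).2.1 hBmem hB1)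
    (3 * n + 1)
  have hZB : ‖Z * B‖ < 1 := (norm_mul_le _ _).trans_lt
    (mul_lt_one_of_nonneg_of_lt_one_left (norm_nonneg _) hZ1 hB1.le)
  have h2 := pair hSQ hS hQ (mul_mem hZ hBmem) hZB
  have h3 := h1.add (h2.add h2)
  have e1 : (3 * n + 1) * 2 + (2 + 2) = 6 * (n + 1) := by ring
  have e2 : ∑ j ∈ Finset.range (3 * n + 1), (2 : ℂ) • (P j * B) +
      ((2 : ℂ) • (S * (Z * B)) + (2 : ℂ) • (S * (Z * B))) = ((6 * (n + 1) : ℕ) : ℂ) • A := by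
    have h4 : (∑ j ∈ Finset.range (3 * n + 1), P j) * B + (2 : ℂ) • (S * (Z * B)) =
        ((3 * n : ℕ) : ℂ) • B := by
      have := congrArg (· * B) hsum
      simpa only [add_mul, smul_mul_assoc, one_mul, mul_assoc] using this
    rw [← Finset.smul_sum, ← Finset.sum_mul]
    calc _ = (2 : ℂ) • ((∑ j ∈ Finset.range (3 * n + 1), P j) * B + (2 : ℂ) • (S * (Z * B))) := by
          module
      _ = _ := by
        rw [h4, hB, smul_smul, smul_smul]
        congr 1
        push_cast
        field_simp
        ring
  rwa [e1, e2] at h3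

end Averages

/-! ### Two isometries with orthogonal ranges in the commutant -/

section Fock

variable {V : Type u} [Quiver.{v} V]

/-- The partial isometries `ξ_v ↦ ξ_{cv}` given by paths `c` that are not terminal segments of one
another are isometries with orthogonal ranges. -/
theorem exists_isOrthogonalPair [Countable V] (hG : UniformAperiodicPathProperty V) :
    ∃ P ∈ rightCommutant V, ∃ Q ∈ rightCommutant V, IsOrthogonalPair P Q := by
  -- Two code words are needed at every vertex, one for each isometry. A single code for all of them
  -- gives both injectivity and orthogonality.
  obtain ⟨c, hc⟩ := hG.exists_code (κ := Fin 2 × V) Prod.snd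
  let g : Fin 2 → FreeSemigroupoid V → FreeSemigroupoid V := fun i v =>
    ⟨v.source, (c (i, v.range)).1, v.path.comp (c (i, v.range)).2⟩
  have hg : ∀ i j v w, g i v = g j w → i = j ∧ v = w := by
    rintro i j ⟨a, b, p⟩ ⟨a', b', p'⟩ h
    injection h with h1 h2 h3
    subst h1
    have h4 := hc (i, b) (j, b') a p p' (Sigma.ext h2 h3)
    obtain ⟨rfl, rfl⟩ := Prod.mk.inj h4
    refine ⟨rfl, ?_⟩
    have h5 := eq_of_heq h3
    rw [Quiver.Path.comp_inj_left] at h5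
    change p = p' at h5
    rw [h5]
  have hinj : ∀ i, PartialInjective fun v => some (g i v) := fun i v w u hv hw =>
    (hg i i v w ((Option.some.inj hv).trans (Option.some.inj hw).symm)).2
  let S : Fin 2 → FockSpace V →L[ℂ] FockSpace V := fun i => pushforward _ (hinj i)
  have hS : ∀ i, S i ∈ rightCommutant V := by
    refine fun i => pushforward_mem_rightCommutant _ fun w v => ?_
    obtain ⟨a, b, p⟩ := w
    obtain ⟨b', d, q⟩ := v
    by_cases hb : b' = b
    · subst hb
      simp [g, rightMul_mk]
    · rw [rightMul_of_ne hb]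
      exact rightMul_of_ne hb
  have hadj : ∀ i w, star (S i) (basisVector w) =
      pullback _ (hinj i) (basisVector w) := fun i w => by
    rw [ContinuousLinearMap.star_eq_adjoint, adjoint_pushforward]
  have hiso : ∀ i, star (S i) * S i = 1 := fun i => by
    refine operator_ext fun w => ?_
    rw [mul_apply_eq_comp, pushforward_basisVector, Option.elim_some, hadj]
    exact pullback_single_some _ rfl
  refine ⟨S 0, hS 0, S 1, hS 1, hiso 0, hiso 1, ?_⟩
  refine operator_ext fun w => ?_
  rw [mul_apply_eq_comp, pushforward_basisVector, Option.elim_some, hadj, zero_apply]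
  exact pullback_single_none _ fun v hv =>
    absurd (hg 0 1 v w (Option.some.inj hv)).1 (by decide)

/-- Inverse-closedness keeps the resolvents in the Möbius transforms inside the algebra. -/
theorem mem_rightCommutant_of_inverse {X G : FockSpace V →L[ℂ] FockSpace V}
    (hX : X ∈ rightCommutant V) (h1 : X * G = 1) (h2 : G * X = 1) : G ∈ rightCommutant V := by
  rw [mem_rightCommutant] at hX ⊢
  intro w
  calc rightTranslation w * G = G * X * rightTranslation w * G := by rw [h2, one_mul]
    _ = G * rightTranslation w * (X * G) := by rw [mul_assoc G, ← hX]; simp only [mul_assoc]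
    _ = G * rightTranslation w := by rw [h1, mul_one]

end Fock

end DirectedGraph

end

theorem theorem4p6 {V : Type*} [Quiver V] [Countable V] [∀ a b : V, Countable (a ⟶ b)]
    (hG : DirectedGraph.UniformAperiodicPathProperty V)
    (A : DirectedGraph.FockSpace V →L[ℂ] DirectedGraph.FockSpace V)
    (hA : A ∈ DirectedGraph.freeSemigroupoidAlgebra V)
    (k : ℕ) (hk : 1 ≤ k) (hnorm : ‖A‖ < 1 - 1 / (k : ℝ)) :
    ∃ U : Fin (6 * k) → (DirectedGraph.FockSpace V →L[ℂ] DirectedGraph.FockSpace V),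
      (∀ i, U i ∈ DirectedGraph.freeSemigroupoidAlgebra V ∧ Isometry (U i)) ∧
        A = ((6 * k : ℕ) : ℂ)⁻¹ • ∑ i, U i := by
  obtain ⟨P, hP, Q, hQ, hPQ⟩ := DirectedGraph.exists_isOrthogonalPair hG
  obtain ⟨U, hU, hsum⟩ := DirectedGraph.isSumOfIsometries_of_norm_lt hP hQ hPQ
    (fun _ hX _ h1 h2 => DirectedGraph.mem_rightCommutant_of_inverse hX h1 h2)
    (fun _ hX h => DirectedGraph.exists_isometric_column hX h)
    (DirectedGraph.mem_freeSemigroupoidAlgebra_iff.1 hA) hk hnorm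
  refine ⟨U, fun i => ⟨DirectedGraph.mem_freeSemigroupoidAlgebra_iff.2 (hU i).1, ?_⟩, ?_⟩
  · refine AddMonoidHomClass.isometry_of_norm _ ?_
    exact (ContinuousLinearMap.norm_map_iff_adjoint_comp_self (U i)).2 (hU i).2
  · rw [← hsum, smul_smul, inv_mul_cancel₀ (by exact_mod_cast (by omega : 6 * k ≠ 0)), one_smul]
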